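/- Let $\mathfrak g$ be a finite-dimensional complex Lie algebra, $\sigma$ an anti-$\mathbb C$-linear involution of $\mathfrak g$ preserving the bracket, $\mathfrak g_\sigma$ its real form of fixed points, and $\mathfrak q$ a complex Lie subalgebra of $\mathfrak g$; the pair $(\mathfrak g_\sigma,\mathfrak q)$ is called a CR-algebra. It is called *parabolic* if $\mathfrak q$ contains a Borel subalgebra (a maximal solvable subalgebra) of $\mathfrak g$, and *integrable* if $\mathfrak q+\sigma(\mathfrak q)$ is a Lie subalgebra of $\mathfrak g$. Let $\mathfrak q^n$ denote the nilradical of $\mathfrak q$ (its largest nilpotent ideal). The *polarization* of $(\mathfrak g_\sigma,\mathfrak q)$ is the CR-algebra $(\mathfrak g_\sigma,\mathfrak q_{[\sigma]})$ with $\mathfrak q_{[\sigma]}=\mathfrak q\cap\sigma(\mathfrak q)+\mathfrak q^n$. A parabolic CR-algebra is *weakly integrable* if $\mathfrak q\cap\sigma(\mathfrak q)+\mathfrak q^n+\sigma(\mathfrak q^n)$ is a Lie subalgebra of $\mathfrak g$. For $Z\in\sigma(\mathfrak q)\setminus\mathfrak q$, the *Levi-order* $k(Z)\in\mathbb N\cup\{+\infty\}$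 is the smallest $k$ for which there exist $Z_1,\dots,Z_k\in\mathfrak q$ with $$[[\cdots[[Z,Z_1],Z_2],\cdots],Z_k]\notin\mathfrak q+\sigma(\mathfrak q),$$ and $k(Z)=+\infty$ if there is no such $k$. The *Levi-order* of $(\mathfrak g_\sigma,\mathfrak q)$ is $\sup\{k(Z)\mid Z\in\sigma(\mathfrak q)\setminus\mathfrak q\}$ (equal to $0$ if $\sigma(\mathfrak q)=\mathfrak q$). **Theorem.** Let $(\mathfrak g_\sigma,\mathfrak q)$ be a parabolic CR-algebra. It is weakly integrable if and only if its polarization is integrable, and in this case its Levi-order is either $+\infty$ or at most $2$. -/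

import Mathlib

/-- An anti-`ℂ`-linear involution of a complex Lie algebra `𝔤` that preserves the bracket
(equivalently, the conjugation of `𝔤` with respect to the real form of its fixed points). -/
structure LieConjugation (𝔤 : Type*) [LieRing 𝔤] [LieAlgebra ℂ 𝔤] where
  /-- the underlying conjugate-linear map -/
  toMap : 𝔤 →ₛₗ[starRingEnd ℂ] 𝔤
  map_lie : ∀ x y : 𝔤, toMap ⁅x, y⁆ = ⁅toMap x, toMap y⁆
  involutive : ∀ x : 𝔤, toMap (toMap x) = x

namespace LieConjugation

variable {𝔤 : Type*} [LieRing 𝔤] [LieAlgebra ℂ 𝔤]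

/-- The image `σ(V)` of a complex subspace. -/
def image (σ : LieConjugation 𝔤) (V : Submodule ℂ 𝔤) : Submodule ℂ 𝔤 :=
  V.map σ.toMap

/-- The image `σ(q)` of a complex Lie subalgebra, as a Lie subalgebra. -/
def imageLie (σ : LieConjugation 𝔤) (q : LieSubalgebra ℂ 𝔤) : LieSubalgebra ℂ 𝔤 where
  toSubmodule := σ.image q.toSubmodule
  lie_mem' := by
    rintro _ _ ⟨x, hx, rfl⟩ ⟨y, hy, rfl⟩
    exact ⟨⁅x, y⁆, q.lie_mem hx hy, σ.map_lie x y⟩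

end LieConjugation

section Subalgebras

variable {𝔤 : Type*} [LieRing 𝔤] [LieAlgebra ℂ 𝔤]

/-- A complex subspace that is the underlying space of a Lie subalgebra. -/
def IsLieSubalgebra (V : Submodule ℂ 𝔤) : Prop :=
  ∀ x ∈ V, ∀ y ∈ V, ⁅x, y⁆ ∈ V

/-- A Borel subalgebra: a maximal solvable Lie subalgebra. -/
def IsBorel (b : LieSubalgebra ℂ 𝔤) : Prop :=
  Maximal (fun s : LieSubalgebra ℂ 𝔤 => LieAlgebra.IsSolvable s) b

/-- A parabolic subalgebra: a Lie subalgebra containing a Borel subalgebra. -/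
def IsParabolicSubalgebra (q : LieSubalgebra ℂ 𝔤) : Prop :=
  ∃ b : LieSubalgebra ℂ 𝔤, IsBorel b ∧ b ≤ q

/-- The nilradical of a Lie algebra: the sum of all its ideals that are nilpotent as Lie algebras
(in finite dimension, the largest nilpotent ideal). Mathlib's `LieAlgebra.maxNilpotentIdeal` is a
different object: it asks that the whole algebra act nilpotently on the ideal. -/
def lieNilradical (L : Type*) [LieRing L] [LieAlgebra ℂ L] : LieIdeal ℂ L :=
  sSup {I : LieIdeal ℂ L | LieRing.IsNilpotent I}

/-- The nilradical `qⁿ` of a Lie subalgebra `q`, as a subspace of the ambient Lie algebra. -/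
def LieSubalgebra.nilradical (q : LieSubalgebra ℂ 𝔤) : Submodule ℂ 𝔤 :=
  (lieNilradical q).toSubmodule.map q.toSubmodule.subtype

theorem LieSubalgebra.nilradical_le (q : LieSubalgebra ℂ 𝔤) : q.nilradical ≤ q.toSubmodule :=
  Submodule.map_subtype_le _ _

theorem LieSubalgebra.lie_mem_nilradical (q : LieSubalgebra ℂ 𝔤) {x y : 𝔤} (hx : x ∈ q)
    (hy : y ∈ q.nilradical) : ⁅x, y⁆ ∈ q.nilradical := by
  obtain ⟨y, hy, rfl⟩ := hy
  exact ⟨⁅(⟨x, hx⟩ : q), y⁆, lie_mem_right ℂ q (lieNilradical q) _ _ hy, rfl⟩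

end Subalgebras

/-- A CR-algebra: a complex Lie algebra `𝔤` with an anti-`ℂ`-linear involution `σ` (whose fixed
points are the symmetry algebra `𝔤_σ`, with complexification `𝔤`) and a complex Lie subalgebra `q`
of `𝔤` (the lifted CR-structure). -/
structure CRAlgebra (𝔤 : Type*) [LieRing 𝔤] [LieAlgebra ℂ 𝔤] where
  /-- the conjugation -/
  σ : LieConjugation 𝔤
  /-- the lifted CR-structure -/
  q : LieSubalgebra ℂ 𝔤

namespace CRAlgebra

variable {𝔤 : Type*} [LieRing 𝔤] [LieAlgebra ℂ 𝔤]

/-- The conjugate `σ(q)` of the lifted CR-structure. -/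
def qConj (A : CRAlgebra 𝔤) : LieSubalgebra ℂ 𝔤 := A.σ.imageLie A.q

/-- The subspace `q + σ(q)`. -/
def contactSpace (A : CRAlgebra 𝔤) : Submodule ℂ 𝔤 :=
  A.q.toSubmodule ⊔ A.qConj.toSubmodule

/-- `q` is a parabolic subalgebra of `𝔤`. -/
def IsParabolic (A : CRAlgebra 𝔤) : Prop := IsParabolicSubalgebra A.q

/-- `q + σ(q)` is a Lie subalgebra. -/
def IsIntegrable (A : CRAlgebra 𝔤) : Prop := IsLieSubalgebra A.contactSpace

/-- `q ∩ σ(q) + qⁿ + σ(qⁿ)` is a Lie subalgebra. -/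
def IsWeaklyIntegrable (A : CRAlgebra 𝔤) : Prop :=
  IsLieSubalgebra (A.q.toSubmodule ⊓ A.qConj.toSubmodule ⊔ A.q.nilradical ⊔
    A.σ.image A.q.nilradical)

/-- The Lie subalgebra `q_[σ] = q ∩ σ(q) + qⁿ`. -/
def polarizedSubalgebra (A : CRAlgebra 𝔤) : LieSubalgebra ℂ 𝔤 where
  toSubmodule := A.q.toSubmodule ⊓ A.qConj.toSubmodule ⊔ A.q.nilradical
  lie_mem' := by
    intro x y hx hy
    obtain ⟨a, ha, n, hn, rfl⟩ := Submodule.mem_sup.1 hx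
    obtain ⟨b, hb, m, hm, rfl⟩ := Submodule.mem_sup.1 hy
    have hbq : b + m ∈ A.q := A.q.add_mem hb.1 (A.q.nilradical_le hm)
    rw [add_lie, lie_add, add_assoc]
    refine Submodule.add_mem_sup ⟨A.q.lie_mem ha.1 hb.1, A.qConj.lie_mem ha.2 hb.2⟩
      (Submodule.add_mem _ (A.q.lie_mem_nilradical ha.1 hm) ?_)
    rw [← lie_skew]
    exact Submodule.neg_mem _ (A.q.lie_mem_nilradical hbq hn)

/-- The polarization `(𝔤_σ, q_[σ])` of a CR-algebra. -/
def polarization (A : CRAlgebra 𝔤) : CRAlgebra 𝔤 where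
  σ := A.σ
  q := A.polarizedSubalgebra

/-- The left-normed higher commutator `[Z, Z₁, …, Zₖ] = [[…[[Z, Z₁], Z₂], …], Zₖ]`. -/
def higherCommutator (Z : 𝔤) (Zs : List 𝔤) : 𝔤 := Zs.foldl (fun X Y => ⁅X, Y⁆) Z

/-- A Levi-sequence for `Z`: a finite sequence in `q` with `[Z, Z₁, …, Zₖ] ∉ q + σ(q)`. -/
def IsLeviSequence (A : CRAlgebra 𝔤) (Z : 𝔤) (Zs : List 𝔤) : Prop :=
  (∀ W ∈ Zs, W ∈ A.q) ∧ higherCommutator Z Zs ∉ A.contactSpace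

/-- The Levi-order of `Z`: the minimal length of a Levi-sequence for `Z`, and `⊤ = +∞` if there is
none. -/
noncomputable def elementLeviOrder (A : CRAlgebra 𝔤) (Z : 𝔤) : ℕ∞ :=
  ⨅ (Zs : List 𝔤) (_ : A.IsLeviSequence Z Zs), (Zs.length : ℕ∞)

/-- The Levi-order of the CR-algebra: the supremum of the Levi-orders of the elements of
`σ(q) ∖ q`. -/
noncomputable def leviOrder (A : CRAlgebra 𝔤) : ℕ∞ :=
  ⨆ (Z : 𝔤) (_ : Z ∈ A.qConj ∧ Z ∉ A.q), A.elementLeviOrder Z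

end CRAlgebra

/-! Write q' = σ(q), V = q + q', and ⊥ for Killing orthogonals. The equivalence is formal: q ∩ q' is
σ-stable, so the polarization has contact space S = q ∩ q' + qⁿ + σ(qⁿ), the space in the definition
of weak integrability.

For the Levi-order it suffices that Z ∈ V, [Z,q] ⊆ V and [[Z,q],q] ⊆ V imply [[[Z,q],q],q] ⊆ V: then
[Z,X] inherits the assumptions for X ∈ q, and no longer commutator leaves V. The radical lies in
every Borel subalgebra, so one may pass to the semisimple quotient. There q and q' contain a common
Cartan subalgebra, and their nilradicals are q^⊥ and q'^⊥ (`LieSubalgebra.map_nilradical`).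
Everything reduces to weight vectors (`lie_lie_lie_mem_sup`).

Suppose T = [[[Z,X₁],X₂],X₃] ∉ V. Reordering the Xᵢ changes T only by elements of V, so every
ordering leaves V; hence no Xᵢ is in q' and no [[Z,Xᵢ],Xⱼ] with i ≠ j is in q. Going back down the
commutators with opposite root vectors places Z and all Xᵢ in S (`mem_of_lie_lie_notMem`). As S is a
subalgebra contained in V, T ∈ V, a contradiction.

The common Cartan subalgebra is found without conjugacy theorems: a Borel subalgebra b contains b^⊥,
b^⊥ is exactly the set of `ad`-nilpotent elements of b, and a suitable element of two Borel
subalgebras has its Engel subalgebra in both. -/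

/-! ### Solvable Lie algebras and Lie's theorem -/

section GeneralLie

open LieAlgebra LieModule

/-- A Lie algebra with solvable image and solvable kernel under a homomorphism is solvable. -/
theorem LieHom.isSolvable_of_ker {R L L' : Type*} [CommRing R] [LieRing L] [LieAlgebra R L]
    [LieRing L'] [LieAlgebra R L'] (f : L →ₗ⁅R⁆ L') [IsSolvable L'] [IsSolvable f.ker] :
    IsSolvable L := by
  obtain ⟨k, hk⟩ := IsSolvable.solvable R L'
  obtain ⟨l, hl⟩ := IsSolvable.solvable R f.ker
  refine IsSolvable.mk (R := R) (k := l + k) ?_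
  have h : derivedSeries R L k ≤ f.ker := by
    rw [← LieIdeal.map_eq_bot_iff, eq_bot_iff, ← hk]
    exact LieIdeal.derivedSeries_map_le k
  rw [derivedSeries_def, derivedSeriesOfIdeal_add, eq_bot_iff]
  rw [LieIdeal.derivedSeries_eq_bot_iff] at hl
  exact (derivedSeriesOfIdeal_mono h l).trans hl.le

/-- A Lie algebra with solvable derived ideal is solvable. -/
theorem LieAlgebra.isSolvable_of_derivedSeries_one (R L : Type*) [CommRing R] [LieRing L]
    [LieAlgebra R L] [IsSolvable (derivedSeries R L 1)] : IsSolvable L := by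
  obtain ⟨k, hk⟩ := IsSolvable.solvable R (derivedSeries R L 1)
  refine IsSolvable.mk (R := R) (k := k + 1) ?_
  rw [derivedSeries_def, derivedSeriesOfIdeal_add]
  exact (LieIdeal.derivedSeries_eq_bot_iff _ k).1 hk

/-- A subalgebra all of whose brackets lie in a solvable subalgebra is solvable. -/
theorem LieSubalgebra.isSolvable_of_lie_mem {R L : Type*} [CommRing R] [LieRing L]
    [LieAlgebra R L] (s t : LieSubalgebra R L) [IsSolvable t]
    (h : ∀ x ∈ s, ∀ y ∈ s, ⁅x, y⁆ ∈ t) : IsSolvable s := by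
  have hle : ∀ x ∈ derivedSeries R s 1, (x : L) ∈ t := by
    intro x hx
    have hx' : x ∈ (derivedSeries R s 1).toSubmodule := hx
    clear hx
    rw [show (derivedSeries R s 1).toSubmodule = Submodule.span R {⁅x, y⁆ | (x : s) (y : s)} from
      coe_derivedSeries_one_eq R s] at hx'
    induction hx' using Submodule.span_induction with
    | mem x hx => obtain ⟨y, z, rfl⟩ := hx; exact h _ y.2 _ z.2
    | zero => exact t.zero_mem
    | add x y _ _ hx hy => exact t.add_mem hx hy
    | smul c x _ hx => exact t.smul_mem c hx
  let f : derivedSeries R s 1 →ₗ⁅R⁆ t :=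
    { toFun := fun x => ⟨((x : s) : L), hle _ x.2⟩
      map_add' := fun _ _ => rfl
      map_smul' := fun _ _ => rfl
      map_lie' := rfl }
  have hf : Function.Injective f := by
    intro x y hxy
    exact Subtype.ext (Subtype.ext (congrArg (fun z : t => (z : L)) hxy))
  have := hf.lieAlgebra_isSolvable
  exact isSolvable_of_derivedSeries_one R s

variable {L : Type*} [LieRing L] [LieAlgebra ℂ L]

/-- An endomorphism killing an invariant subspace and nilpotent modulo it is nilpotent. -/
theorem Module.End.isNilpotent_of_mapQ {K M : Type*} [Field K] [AddCommGroup M] [Module K M]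
    (f : Module.End K M) (W : Submodule K M) (hW : W ≤ W.comap f)
    (hq : IsNilpotent (W.mapQ W f hW)) (h0 : ∀ m ∈ W, f m = 0) : IsNilpotent f := by
  obtain ⟨k, hk⟩ := hq
  refine ⟨k + 1, ?_⟩
  ext m
  have hmem : (f ^ k) m ∈ W := by
    have h := congrArg (fun g => g (W.mkQ m)) (Submodule.mapQ_pow (p := W) (f := f) hW k)
    simp only [hk] at h
    rw [← Submodule.Quotient.mk_eq_zero]
    simpa using h
  rw [pow_succ', Module.End.mul_apply]
  exact h0 _ hmem

/-- A finite-dimensional module over a Lie algebra with a solvable ideal `s` has a nonzero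
submodule on which `s` acts by scalars. -/
theorem LieIdeal.exists_lieSubmodule_smul (s : LieIdeal ℂ L) [IsSolvable s]
    (M : Type*) [AddCommGroup M] [Module ℂ M] [LieRingModule L M] [LieModule ℂ L M]
    [FiniteDimensional ℂ M] [Nontrivial M] :
    ∃ (χ : s → ℂ) (W : LieSubmodule ℂ L M),
      Module.finrank ℂ (M ⧸ W) < Module.finrank ℂ M ∧ W ≠ ⊥ ∧
      ∀ m ∈ W, ∀ y : s, ⁅(y : L), m⁆ = χ y • m := by
  obtain ⟨χ, hχ⟩ := exists_nontrivial_weightSpace_of_isSolvable ℂ s M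
  let W : LieSubmodule ℂ L M := weightSpaceOfIsLieTower ℂ M χ
  have hWne : W ≠ ⊥ := by
    rw [← LieSubmodule.nontrivial_iff_ne_bot ℂ L M]; exact hχ
  refine ⟨χ, W, ?_, hWne, fun m hm => (mem_weightSpace (R := ℂ) (L := s) χ m).1 hm⟩
  have h := Submodule.finrank_quotient_add_finrank W.toSubmodule
  have hpos : 0 < Module.finrank ℂ W.toSubmodule :=
    Module.finrank_pos_iff.2 ((LieSubmodule.nontrivial_iff_ne_bot ℂ L M).2 hWne)
  have h' : Module.finrank ℂ (M ⧸ W) = Module.finrank ℂ (M ⧸ W.toSubmodule) := rfl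
  omega

/-- For a solvable ideal `s` of `L`, the ideal `⁅L, s⁆` acts nilpotently on every
finite-dimensional module. -/
theorem LieIdeal.isNilpotent_toEnd_of_mem_top_lie (s : LieIdeal ℂ L) [IsSolvable s]
    (M : Type*) [AddCommGroup M] [Module ℂ M] [LieRingModule L M] [LieModule ℂ L M]
    [FiniteDimensional ℂ M] {x : L} (hx : x ∈ (⁅(⊤ : LieIdeal ℂ L), s⁆ : LieIdeal ℂ L)) :
    IsNilpotent (toEnd ℂ L M x) := by
  induction hn : Module.finrank ℂ M using Nat.strong_induction_on generalizing M with
  | _ n ih =>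
  rcases subsingleton_or_nontrivial M with hM | hM
  · exact ⟨1, by ext m; exact Subsingleton.elim _ _⟩
  obtain ⟨χ, W, hlt, -, hW⟩ := s.exists_lieSubmodule_smul M
  refine Module.End.isNilpotent_of_mapQ _ W.toSubmodule (fun m hm => W.lie_mem hm)
    (ih _ (hn ▸ hlt) (M ⧸ W) rfl) ?_
  intro m hm
  clear ih
  rw [← LieSubmodule.mem_toSubmodule, LieSubmodule.lieIdeal_oper_eq_linear_span'] at hx
  induction hx using Submodule.span_induction with
  | mem x hx =>
    obtain ⟨z, -, y, hy, rfl⟩ := hx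
    -- Both m and [z,m] lie in W, where y acts by the same scalar, so the two terms of [[z,y],m]
    -- cancel.
    have h1 := hW _ hm ⟨y, hy⟩
    have h2 := hW _ (W.lie_mem (x := z) hm) ⟨y, hy⟩
    simp only at h1 h2
    rw [toEnd_apply_apply, lie_lie, h2, h1, lie_smul, sub_self]
  | zero => simp
  | add x y _ _ hx hy => rw [map_add, LinearMap.add_apply, hx, hy, add_zero]
  | smul c x _ hx => rw [map_smul, LinearMap.smul_apply, hx, smul_zero]

/-- Lie's theorem, in the form of an induction on invariant subspaces. -/
theorem LieModule.exists_lieSubmodule_smul_of_isSolvable [IsSolvable L]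
    (M : Type*) [AddCommGroup M] [Module ℂ M] [LieRingModule L M] [LieModule ℂ L M]
    [FiniteDimensional ℂ M] [Nontrivial M] :
    ∃ (χ : L → ℂ) (W : LieSubmodule ℂ L M),
      Module.finrank ℂ (M ⧸ W) < Module.finrank ℂ M ∧ W ≠ ⊥ ∧
      ∀ m ∈ W, ∀ y : L, ⁅y, m⁆ = χ y • m := by
  obtain ⟨χ, W, h1, h2, h3⟩ := (⊤ : LieIdeal ℂ L).exists_lieSubmodule_smul M
  exact ⟨fun y => χ ⟨y, LieSubmodule.mem_top y⟩, W, h1, h2,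
    fun m hm y => h3 m hm ⟨y, LieSubmodule.mem_top y⟩⟩

/-- If a nilpotent endomorphism acts on a nonzero vector by a scalar, the scalar is zero. -/
theorem Module.End.eq_zero_of_isNilpotent_of_apply_eq_smul {K M : Type*} [Field K]
    [AddCommGroup M] [Module K M] {f : Module.End K M} (hf : IsNilpotent f) {m : M} (hm : m ≠ 0)
    {c : K} (h : f m = c • m) : c = 0 := by
  obtain ⟨k, hk⟩ := hf
  have hpow : ∀ j, (f ^ j) m = c ^ j • m := by
    intro j
    induction j with
    | zero => simp
    | succ j ih => rw [pow_succ', Module.End.mul_apply, ih, map_smul, h, smul_smul, pow_succ]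
  have := hpow k
  rw [hk, LinearMap.zero_apply, eq_comm, smul_eq_zero] at this
  exact eq_zero_of_pow_eq_zero (this.resolve_right hm)

/-- The image of a nilpotent endomorphism on a quotient is nilpotent. -/
theorem LieModule.isNilpotent_toEnd_quotient {M : Type*} [AddCommGroup M] [Module ℂ M]
    [LieRingModule L M] [LieModule ℂ L M] (W : LieSubmodule ℂ L M) {u : L}
    (hu : _root_.IsNilpotent (toEnd ℂ L M u)) : _root_.IsNilpotent (toEnd ℂ L (M ⧸ W) u) :=
  Module.End.IsNilpotent.mapQ (p := W.toSubmodule) (fun _ hm => W.lie_mem hm) hu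

/-- In a representation of a solvable Lie algebra, the product of a nilpotent operator of the
representation with any other operator of the representation is nilpotent. -/
theorem LieModule.isNilpotent_toEnd_mul_of_isSolvable [IsSolvable L]
    (M : Type*) [AddCommGroup M] [Module ℂ M] [LieRingModule L M] [LieModule ℂ L M]
    [FiniteDimensional ℂ M] {u : L} (hu : _root_.IsNilpotent (toEnd ℂ L M u)) (z : L) :
    _root_.IsNilpotent (toEnd ℂ L M u * toEnd ℂ L M z) := by
  induction hn : Module.finrank ℂ M using Nat.strong_induction_on generalizing M with
  | _ n ih =>
  rcases subsingleton_or_nontrivial M with hM | hM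
  · exact ⟨1, by ext m; exact Subsingleton.elim _ _⟩
  obtain ⟨χ, W, hlt, hne, hW⟩ := exists_lieSubmodule_smul_of_isSolvable (L := L) M
  refine Module.End.isNilpotent_of_mapQ _ W.toSubmodule
    (fun m hm => W.lie_mem (W.lie_mem hm)) ?_ ?_
  · convert! ih _ (hn ▸ hlt) (M ⧸ W) (isNilpotent_toEnd_quotient W hu) rfl using 1
    ext m
    rfl
  · intro m hm
    rcases eq_or_ne m 0 with rfl | hm0
    · simp
    -- On W the element u acts by a scalar, which nilpotency forces to be 0; hence the product kills
    -- W.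
    have h0 := Module.End.eq_zero_of_isNilpotent_of_apply_eq_smul hu hm0 (hW m hm u)
    rw [Module.End.mul_apply, toEnd_apply_apply, toEnd_apply_apply, hW m hm z, lie_smul,
      hW m hm u, h0, zero_smul, smul_zero]

/-- In a representation of a solvable Lie algebra, adding a nilpotent operator of the
representation to an injective one gives an injective operator. -/
theorem LieModule.eq_zero_of_lie_add_eq_zero_of_isSolvable [IsSolvable L]
    (M : Type*) [AddCommGroup M] [Module ℂ M] [LieRingModule L M] [LieModule ℂ L M]
    [FiniteDimensional ℂ M] {u z : L} (hu : _root_.IsNilpotent (toEnd ℂ L M u))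
    (hz : Function.Injective (toEnd ℂ L M z)) {m : M} (hm : ⁅z + u, m⁆ = 0) : m = 0 := by
  induction hn : Module.finrank ℂ M using Nat.strong_induction_on generalizing M with
  | _ n ih =>
  by_contra hm0
  have hM : Nontrivial M := nontrivial_of_ne m 0 hm0
  obtain ⟨χ, W, hlt, hne, hW⟩ := exists_lieSubmodule_smul_of_isSolvable (L := L) M
  -- Injectivity descends to the quotient by way of surjectivity, in finite dimension.
  have hz' : Function.Injective (toEnd ℂ L (M ⧸ W) z) := by
    apply LinearMap.injective_iff_surjective.2
    intro y
    obtain ⟨y, rfl⟩ := LieSubmodule.Quotient.surjective_mk' W y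
    obtain ⟨w, rfl⟩ := LinearMap.injective_iff_surjective.1 hz y
    exact ⟨LieSubmodule.Quotient.mk w, rfl⟩
  have hmW : m ∈ W := by
    rw [← LieSubmodule.Quotient.mk_eq_zero]
    refine ih _ (hn ▸ hlt) (M ⧸ W) (isNilpotent_toEnd_quotient W hu) hz' ?_ rfl
    rw [← LieModuleHom.map_lie, hm, map_zero]
  have h0 := Module.End.eq_zero_of_isNilpotent_of_apply_eq_smul hu hm0 (hW m hmW u)
  apply hm0
  apply hz
  rw [map_zero, toEnd_apply_apply, ← hm, add_lie, hW m hmW u, h0, zero_smul, add_zero]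

end GeneralLie

/-! ### Orthogonals for the Killing form -/

section KillingPerp

open LieAlgebra LieModule

variable {L : Type*} [LieRing L] [LieAlgebra ℂ L]

/-- The orthogonal of a subspace with respect to the Killing form. -/
noncomputable def killingPerp (V : Submodule ℂ L) : Submodule ℂ L :=
  (killingForm ℂ L).orthogonal V

theorem mem_killingPerp {V : Submodule ℂ L} {x : L} :
    x ∈ killingPerp V ↔ ∀ y ∈ V, killingForm ℂ L x y = 0 := by
  rw [killingPerp, LinearMap.BilinForm.mem_orthogonal_iff]
  refine forall₂_congr fun y _ => ?_
  rw [LieModule.traceForm_comm]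

theorem killingPerp_anti {V W : Submodule ℂ L} (h : V ≤ W) : killingPerp W ≤ killingPerp V :=
  fun _ hx => mem_killingPerp.2 fun y hy => mem_killingPerp.1 hx y (h hy)

theorem killingPerp_sup (V W : Submodule ℂ L) :
    killingPerp (V ⊔ W) = killingPerp V ⊓ killingPerp W := by
  refine le_antisymm (le_inf (killingPerp_anti le_sup_left) (killingPerp_anti le_sup_right)) ?_
  intro x hx
  refine mem_killingPerp.2 fun y hy => ?_
  obtain ⟨a, ha, b, hb, rfl⟩ := Submodule.mem_sup.1 hy
  rw [map_add, mem_killingPerp.1 hx.1 a ha, mem_killingPerp.1 hx.2 b hb, add_zero]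

theorem killingForm_lie_left (x y z : L) :
    killingForm ℂ L ⁅x, y⁆ z = - killingForm ℂ L y ⁅x, z⁆ := by
  rw [← lie_skew, map_neg, LinearMap.neg_apply, LieModule.traceForm_apply_lie_apply]

/-- If `x` normalizes `V` then it normalizes the orthogonal of `V`. -/
theorem lie_mem_killingPerp {V : Submodule ℂ L} {x y : L} (hx : ∀ v ∈ V, ⁅x, v⁆ ∈ V)
    (hy : y ∈ killingPerp V) : ⁅x, y⁆ ∈ killingPerp V :=
  mem_killingPerp.2 fun z hz => by
    rw [killingForm_lie_left, mem_killingPerp.1 hy _ (hx z hz), neg_zero]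

/-- The orthogonal of a subalgebra is stable under right brackets with the subalgebra. -/
theorem lie_mem_killingPerp_left {q : LieSubalgebra ℂ L} {x y : L}
    (hx : x ∈ killingPerp q.toSubmodule) (hy : y ∈ q) :
    ⁅x, y⁆ ∈ killingPerp q.toSubmodule := by
  rw [← lie_skew]
  exact Submodule.neg_mem _ (lie_mem_killingPerp (fun v hv => q.lie_mem hy hv) hx)

variable [FiniteDimensional ℂ L] [IsKilling ℂ L]

theorem killingPerp_killingPerp (V : Submodule ℂ L) : killingPerp (killingPerp V) = V :=
  LinearMap.BilinForm.orthogonal_orthogonal (IsKilling.killingForm_nondegenerate ℂ L)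
    (LieModule.traceForm_isSymm ℂ L L).isRefl V

end KillingPerp

/-! ### Root vectors, stable subspaces and sl₂-strings -/

section RootSpaces

set_option linter.unusedSectionVars false

open LieAlgebra LieModule IsKilling

variable {L : Type*} [LieRing L] [LieAlgebra ℂ L] [FiniteDimensional ℂ L] [IsKilling ℂ L]
  {H : LieSubalgebra ℂ L} [H.IsCartanSubalgebra]

/-- A subspace stable under a Cartan subalgebra is spanned by weight vectors. -/
theorem induction_of_cartan_stable {V : Submodule ℂ L} (hV : ∀ h ∈ H, ∀ v ∈ V, ⁅h, v⁆ ∈ V)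
    {P : L → Prop} (zero : P 0) (add : ∀ x y, P x → P y → P (x + y))
    (weight : ∀ (α : H → ℂ) (v : L), v ∈ V → v ∈ rootSpace H α → P v) {v : L} (hv : v ∈ V) :
    P v := by
  let N : LieSubmodule ℂ H L := { V with lie_mem := fun {h v} hv => hV h h.2 v hv }
  have hN : v ∈ N := hv
  clear hv
  rw [LieModule.eq_iSup_inf_genWeightSpace ℂ H L N] at hN
  induction hN using LieSubmodule.iSup_induction' with
  | mem α x hx => exact weight α x hx.1 hx.2
  | zero => exact zero
  | add x y _ _ hx hy => exact add x y hx hy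

theorem mem_cartan_of_mem_rootSpace_zero {x : L} (hx : x ∈ rootSpace H (0 : H → ℂ)) : x ∈ H := by
  rwa [rootSpace_zero_eq, LieSubalgebra.mem_toLieSubmodule] at hx

theorem rootSpace_smul_of_ne_zero {α : H → ℂ} (hα : α ≠ 0) {x y : L} (hx : x ∈ rootSpace H α)
    (hx0 : x ≠ 0) (hy : y ∈ rootSpace H α) : ∃ c : ℂ, y = c • x := by
  have hne : rootSpace H α ≠ ⊥ := fun h => hx0 (by rw [h] at hx; exact hx)
  let w : Weight ℂ H L := ⟨α, hne⟩
  have hw : w.IsNonZero := fun h => hα h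
  have h1 := finrank_rootSpace_eq_one w hw
  obtain ⟨c, hc⟩ := (finrank_eq_one_iff_of_nonzero' (⟨x, hx⟩ : rootSpace H α)
    (fun h => hx0 (congrArg Subtype.val h))).1 h1 ⟨y, hy⟩
  exact ⟨c, (congrArg Subtype.val hc).symm⟩

/-- If a nonzero weight vector of a nonzero weight does not lie in a stable subspace `V`, then the
opposite root space is orthogonal to `V`. -/
theorem mem_killingPerp_of_notMem {V : Submodule ℂ L} (hV : ∀ h ∈ H, ∀ v ∈ V, ⁅h, v⁆ ∈ V)
    {α : H → ℂ} (hα : α ≠ 0) {x f : L} (hx : x ∈ rootSpace H α) (hxV : x ∉ V)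
    (hf : f ∈ rootSpace H (-α)) : f ∈ killingPerp V := by
  refine mem_killingPerp.2 fun v hv => ?_
  refine induction_of_cartan_stable hV (P := fun v => killingForm ℂ L f v = 0) (map_zero _)
    (fun x y hx hy => by rw [map_add, hx, hy, add_zero]) (fun β y hyV hy => ?_) hv
  by_cases hβ : -α + β = 0
  · obtain rfl : β = α := by rwa [neg_add_eq_zero, eq_comm] at hβ
    rcases eq_or_ne y 0 with rfl | hy0
    · exact map_zero _
    · obtain ⟨c, rfl⟩ := rootSpace_smul_of_ne_zero hα hy hy0 hx
      exact absurd (V.smul_mem c hyV) hxV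
  · exact killingForm_apply_eq_zero_of_mem_rootSpace_of_add_ne_zero ℂ L H hf hy hβ

theorem eq_zero_of_mem_rootSpace_of_killingForm {α : H → ℂ} {x : L} (hx : x ∈ rootSpace H α)
    (h : ∀ y ∈ rootSpace H (-α), killingForm ℂ L x y = 0) : x = 0 := by
  have := mem_ker_killingForm_of_mem_rootSpace_of_forall_rootSpace_neg ℂ L H hx h
  rwa [ker_killingForm_eq_bot, Submodule.mem_bot] at this

/-- A weight vector of nonzero weight in a sum of two stable subspaces lies in one of them. -/
theorem mem_or_mem_of_mem_sup {V W : Submodule ℂ L} (hV : ∀ h ∈ H, ∀ v ∈ V, ⁅h, v⁆ ∈ V)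
    (hW : ∀ h ∈ H, ∀ v ∈ W, ⁅h, v⁆ ∈ W) {α : H → ℂ} (hα : α ≠ 0) {x : L}
    (hx : x ∈ rootSpace H α) (hxVW : x ∈ V ⊔ W) : x ∈ V ∨ x ∈ W := by
  by_contra! h
  -- If x is in neither subspace, the root space of -α is orthogonal to both, hence to x; but it is
  -- in duality with the root space of α.
  have hx0 : x = 0 := eq_zero_of_mem_rootSpace_of_killingForm hx fun f hf => by
    rw [LieModule.traceForm_comm]
    refine mem_killingPerp.1 (?_ : f ∈ killingPerp (V ⊔ W)) x hxVW
    rw [killingPerp_sup]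
    exact ⟨mem_killingPerp_of_notMem hV hα hx h.1 hf, mem_killingPerp_of_notMem hW hα hx h.2 hf⟩
  exact h.1 (hx0 ▸ V.zero_mem)

/-- In a finite-dimensional representation of `sl₂`, a weight vector killed by `f` and lying in the
image of `e` is zero. -/
theorem IsSl2Triple.lie_e_eq_zero_of_lie_f {h e f : L} (t : IsSl2Triple h e f) {x : L} {c : ℂ}
    (hx : ⁅h, x⁆ = c • x) (hf : ⁅f, ⁅e, x⁆⁆ = 0) : ⁅e, x⁆ = 0 := by
  by_contra hv
  have hlie : ⁅h, ⁅e, x⁆⁆ = (c + 2) • ⁅e, x⁆ := by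
    rw [leibniz_lie, t.lie_h_e_smul ℂ, hx, smul_lie, lie_smul, ← add_smul, add_comm]
  have P : t.symm.HasPrimitiveVectorWith ⁅e, x⁆ (-(c + 2)) :=
    ⟨hv, by rw [neg_lie, hlie, neg_smul], hf⟩
  obtain ⟨m, hm⟩ := P.exists_nat
  -- The lowest weight of a finite-dimensional module is -m with m natural, so x has weight -m - 2.
  -- Applying f repeatedly to x never gives 0, since the coefficients (n+1)(m+2+n) do not vanish;
  -- this yields infinitely many eigenvalues of h.
  have hc : c = -(m : ℂ) - 2 := by linear_combination -hm
  let ψ : ℕ → L := fun n => ((toEnd ℂ L L f) ^ n) x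
  have hψ : ∀ n, ψ (n + 1) = ⁅f, ψ n⁆ := fun n => by
    simp only [ψ, pow_succ', Module.End.mul_apply, toEnd_apply_apply]
  have hhψ : ∀ n : ℕ, ⁅h, ψ n⁆ = (c - 2 * n) • ψ n := by
    intro n
    induction n with
    | zero => simp [ψ, hx]
    | succ n ih =>
      rw [hψ, leibniz_lie, t.lie_lie_smul_f ℂ, ih, lie_smul, neg_lie, smul_lie, ← neg_smul,
        ← add_smul]
      congr 1
      push_cast
      ring
  have heψ : ∀ n : ℕ, ⁅e, ψ (n + 1)⁆ = (-((n + 1) * (m + 2 + n)) : ℂ) • ψ n := by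
    intro n
    induction n with
    | zero =>
      rw [hψ, leibniz_lie, t.lie_e_f, hhψ, show ψ 0 = x from rfl, hf, add_zero, hc]
      congr 1
      push_cast
      ring
    | succ n ih =>
      rw [hψ (n + 1), leibniz_lie, t.lie_e_f, hhψ, ih, lie_smul, ← hψ, ← add_smul, hc]
      congr 1
      push_cast
      ring
  have hne : ∀ n, ψ n ≠ 0 := by
    intro n
    induction n with
    | zero => intro h0; apply hv; rw [show x = 0 from h0, lie_zero]
    | succ n ih =>
      intro h0
      have h1 := heψ n
      rw [h0, lie_zero, eq_comm, smul_eq_zero] at h1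
      refine h1.elim (fun h2 => ?_) ih
      rw [neg_eq_zero, mul_eq_zero] at h2
      rcases h2 with h2 | h2 <;> norm_cast at h2
      omega
  have hinj : Function.Injective fun n : ℕ => c - 2 * (n : ℂ) := by
    intro a b hab
    simpa using hab
  have hinf : (Set.range fun n : ℕ => c - 2 * (n : ℂ)).Infinite := Set.infinite_range_of_injective hinj
  refine hinf ((Module.End.finite_hasEigenvalue (toEnd ℂ L L h)).subset ?_)
  rintro _ ⟨n, rfl⟩
  exact Module.End.hasEigenvalue_of_hasEigenvector (x := ψ n)
    ⟨Module.End.mem_eigenspace_iff.2 (hhψ n), hne n⟩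

/-- If `⁅a, x⁆ ≠ 0` for root vectors `a` and `x`, bracketing back with an opposite root vector of `a`
does not give zero. -/
theorem lie_lie_ne_zero {α β : H → ℂ} (hα : α ≠ 0) {a x f : L} (ha : a ∈ rootSpace H α)
    (hx : x ∈ rootSpace H β) (hax : ⁅a, x⁆ ≠ 0) (hf : f ∈ rootSpace H (-α)) (hf0 : f ≠ 0) :
    ⁅f, ⁅a, x⁆⁆ ≠ 0 := by
  have ha0 : a ≠ 0 := fun h => hax (by rw [h, zero_lie])
  have hne : rootSpace H α ≠ ⊥ := fun h => ha0 (by rw [h] at ha; exact ha)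
  let w : Weight ℂ H L := ⟨α, hne⟩
  have hw : w.IsNonZero := fun h => hα h
  obtain ⟨h, e, f', t, he, hf'⟩ := exists_isSl2Triple_of_weight_isNonZero hw
  obtain ⟨c, rfl⟩ := rootSpace_smul_of_ne_zero hα he t.e_ne_zero ha
  obtain ⟨d, rfl⟩ := rootSpace_smul_of_ne_zero (neg_ne_zero.2 hα) hf' t.f_ne_zero hf
  have hd : d ≠ 0 := fun h => hf0 (by rw [h, zero_smul])
  have hc : c ≠ 0 := fun h => ha0 (by rw [h, zero_smul])
  intro h0
  rw [smul_lie, smul_lie, lie_smul, smul_eq_zero, smul_eq_zero] at h0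
  have h1 := (h0.resolve_left hd).resolve_left hc
  have hh := t.h_eq_coroot hw he hf'
  have hhx : ⁅h, x⁆ = β (coroot w) • x := by
    rw [hh]; exact lie_eq_smul_of_mem_rootSpace hx (coroot w)
  exact hax (by rw [smul_lie, t.lie_e_eq_zero_of_lie_f hhx h1, smul_zero])

end RootSpaces

/-! ### Levi sequences in the semisimple case -/

section Core

open LieAlgebra LieModule IsKilling

variable {L : Type*} [LieRing L] [LieAlgebra ℂ L] [FiniteDimensional ℂ L] [IsKilling ℂ L]
  {H : LieSubalgebra ℂ L} [H.IsCartanSubalgebra]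

/-- A root vector bracketed into a subspace by a root vector `x` lies in any subspace that
contains the brackets of the opposite root space of `x` with the result. -/
theorem mem_of_lie_rootSpace_neg {V : Submodule ℂ L} {α β : H → ℂ} (hα : α ≠ 0) (hβ : β ≠ 0)
    {a x : L} (ha : a ∈ rootSpace H α) (hx : x ∈ rootSpace H β) (hax : ⁅a, x⁆ ≠ 0)
    (hV : ∀ f ∈ rootSpace H (-β), ⁅f, ⁅a, x⁆⁆ ∈ V) : a ∈ V := by
  have hx0 : x ≠ 0 := fun h => hax (by rw [h, lie_zero])
  have hxa : ⁅x, a⁆ ≠ 0 := by rwa [← lie_skew, neg_ne_zero]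
  obtain ⟨f, hf, hfx⟩ : ∃ f ∈ rootSpace H (-β), f ≠ 0 := by
    by_contra! h
    exact hx0 (eq_zero_of_mem_rootSpace_of_killingForm hx fun y hy => by rw [h y hy, map_zero])
  -- [f,[x,a]] is nonzero of weight α, and root spaces are lines, so a is a multiple of it.
  have hne := lie_lie_ne_zero hβ hx ha hxa hf hfx
  have hmem : ⁅f, ⁅x, a⁆⁆ ∈ rootSpace H α := by
    have h1 := lie_mem_genWeightSpace_of_mem_genWeightSpace hx ha
    have h2 := lie_mem_genWeightSpace_of_mem_genWeightSpace hf h1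
    rwa [neg_add_cancel_left] at h2
  obtain ⟨c, hc⟩ := rootSpace_smul_of_ne_zero hα hmem hne ha
  rw [hc]
  refine V.smul_mem c ?_
  rw [← lie_skew x, lie_neg]
  exact V.neg_mem (hV f hf)

variable {q q' : LieSubalgebra ℂ L}

/-- The local step: the relation between the members of a Levi sequence of length `3`. -/
theorem mem_of_lie_lie_notMem (hHq : H ≤ q) (hHq' : H ≤ q') {S : Submodule ℂ L}
    (hS : ∀ x ∈ S, ∀ y ∈ S, ⁅x, y⁆ ∈ S) (hnS : killingPerp q.toSubmodule ≤ S)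
    (hnS' : killingPerp q'.toSubmodule ≤ S) {α β γ : H → ℂ} {Z X Y : L}
    (hZ : Z ∈ rootSpace H α) (hX : X ∈ rootSpace H β) (hY : Y ∈ rootSpace H γ)
    (hXq : X ∈ q) (hYq : Y ∈ q) (hXq' : X ∉ q') (hYq' : Y ∉ q')
    (h1 : ⁅Z, X⁆ ∈ q.toSubmodule ⊔ q'.toSubmodule)
    (h2 : ⁅⁅Z, X⁆, Y⁆ ∈ q.toSubmodule ⊔ q'.toSubmodule) (h2q : ⁅⁅Z, X⁆, Y⁆ ∉ q) :
    Z ∈ S ∧ X ∈ S := by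
  have hstq : ∀ h ∈ H, ∀ v ∈ q.toSubmodule, ⁅h, v⁆ ∈ q.toSubmodule :=
    fun h hh v hv => q.lie_mem (hHq hh) hv
  have hstq' : ∀ h ∈ H, ∀ v ∈ q'.toSubmodule, ⁅h, v⁆ ∈ q'.toSubmodule :=
    fun h hh v hv => q'.lie_mem (hHq' hh) hv
  have hne : ∀ {δ : H → ℂ} {r : LieSubalgebra ℂ L}, H ≤ r → ∀ {v : L}, v ∈ rootSpace H δ →
      v ∉ r → δ ≠ 0 := by
    rintro δ r hr v hv hvr rfl
    exact hvr (hr (mem_cartan_of_mem_rootSpace_zero hv))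
  have h1q : ⁅Z, X⁆ ∉ q := fun h => h2q (q.lie_mem h hYq)
  have hZq : Z ∉ q := fun h => h1q (q.lie_mem h hXq)
  have hα := hne hHq hZ hZq
  have hβ := hne hHq' hX hXq'
  have hγ := hne hHq' hY hYq'
  have hZX := lie_mem_genWeightSpace_of_mem_genWeightSpace hZ hX
  have hZXY := lie_mem_genWeightSpace_of_mem_genWeightSpace hZX hY
  have hαβ := hne hHq hZX h1q
  have hαβγ := hne hHq hZXY h2q
  have h1q' := (mem_or_mem_of_mem_sup hstq hstq' hαβ hZX h1).resolve_left h1q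
  have h2q' := (mem_or_mem_of_mem_sup hstq hstq' hαβγ hZXY h2).resolve_left h2q
  -- As Y ∉ q', the root space of -γ lies in q'^⊥, and [q'^⊥, q'] ⊆ q'^⊥. Coming back from [[Z,X],Y]
  -- ∈ q' therefore lands in q'^⊥; the same argument with X takes [Z,X] back to Z.
  have h1n : ⁅Z, X⁆ ∈ killingPerp q'.toSubmodule :=
    mem_of_lie_rootSpace_neg hαβ hγ hZX hY (fun h => h2q (h ▸ q.zero_mem)) fun f hf =>
      lie_mem_killingPerp_left (mem_killingPerp_of_notMem hstq' hγ hY hYq' hf) h2q'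
  have hZn : Z ∈ killingPerp q'.toSubmodule :=
    mem_of_lie_rootSpace_neg hα hβ hZ hX (fun h => h1q (h ▸ q.zero_mem)) fun f hf =>
      lie_mem_killingPerp_left (mem_killingPerp_of_notMem hstq' hβ hX hXq' hf) h1q'
  -- Now [Z,X] is brought back to X through the root space of -α. As Z ∉ q, that space lies in q^⊥ ⊆
  -- S, while [Z,X] ∈ q'^⊥ ⊆ S: here S must be a subalgebra.
  refine ⟨hnS' hZn, mem_of_lie_rootSpace_neg hβ hα hX hZ (fun h => h1q ?_) fun f hf => ?_⟩
  · rw [← lie_skew, h, neg_zero]; exact q.zero_mem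
  · refine hS _ (hnS (mem_killingPerp_of_notMem hstq hα hZ hZq hf)) _ ?_
    rw [← lie_skew]
    exact S.neg_mem (hnS' h1n)

/-- Let `q`, `q'` be subalgebras containing a common Cartan subalgebra and their own orthogonals. If
`q ⊓ q' + q^⊥ + q'^⊥` is a subalgebra, then the elements `Z` with
`Z, ⁅Z, q⁆, ⁅⁅Z, q⁆, q⁆ ⊆ q + q'` also satisfy `⁅⁅⁅Z, q⁆, q⁆, q⁆ ⊆ q + q'`. -/
theorem lie_lie_lie_mem_sup (hHq : H ≤ q) (hHq' : H ≤ q')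
    (hn : killingPerp q.toSubmodule ≤ q.toSubmodule)
    (hn' : killingPerp q'.toSubmodule ≤ q'.toSubmodule)
    (hS : ∀ x ∈ q.toSubmodule ⊓ q'.toSubmodule ⊔ killingPerp q.toSubmodule ⊔
        killingPerp q'.toSubmodule, ∀ y ∈ q.toSubmodule ⊓ q'.toSubmodule ⊔
        killingPerp q.toSubmodule ⊔ killingPerp q'.toSubmodule,
      ⁅x, y⁆ ∈ q.toSubmodule ⊓ q'.toSubmodule ⊔ killingPerp q.toSubmodule ⊔
        killingPerp q'.toSubmodule)
    {Z : L} (h0 : Z ∈ q.toSubmodule ⊔ q'.toSubmodule)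
    (h1 : ∀ X ∈ q, ⁅Z, X⁆ ∈ q.toSubmodule ⊔ q'.toSubmodule)
    (h2 : ∀ X ∈ q, ∀ Y ∈ q, ⁅⁅Z, X⁆, Y⁆ ∈ q.toSubmodule ⊔ q'.toSubmodule) :
    ∀ X₁ ∈ q, ∀ X₂ ∈ q, ∀ X₃ ∈ q, ⁅⁅⁅Z, X₁⁆, X₂⁆, X₃⁆ ∈ q.toSubmodule ⊔ q'.toSubmodule := by
  set V : Submodule ℂ L := q.toSubmodule ⊔ q'.toSubmodule with hV
  set S : Submodule ℂ L := q.toSubmodule ⊓ q'.toSubmodule ⊔ killingPerp q.toSubmodule ⊔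
    killingPerp q'.toSubmodule with hSdef
  have hSV : S ≤ V := sup_le (sup_le (inf_le_left.trans le_sup_left) (hn.trans le_sup_left))
    (hn'.trans le_sup_right)
  have hqV : ∀ {v}, v ∈ q → v ∈ V := fun {v} hv => Submodule.mem_sup_left hv
  have hstq : ∀ h ∈ H, ∀ v ∈ q.toSubmodule, ⁅h, v⁆ ∈ q.toSubmodule :=
    fun h hh v hv => q.lie_mem (hHq hh) hv
  have hstV : ∀ h ∈ H, ∀ v ∈ V, ⁅h, v⁆ ∈ V := by
    intro h hh v hv
    obtain ⟨a, ha, b, hb, rfl⟩ := Submodule.mem_sup.1 hv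
    rw [lie_add]
    exact Submodule.add_mem_sup (q.lie_mem (hHq hh) ha) (q'.lie_mem (hHq' hh) hb)
  -- The assumptions on Z must pass to its weight components; this holds because the elements
  -- satisfying them form an H-stable subspace.
  let F : Submodule ℂ L :=
    { carrier := {Z | Z ∈ V ∧ (∀ X ∈ q, ⁅Z, X⁆ ∈ V) ∧ ∀ X ∈ q, ∀ Y ∈ q, ⁅⁅Z, X⁆, Y⁆ ∈ V}
      zero_mem' := by simp
      add_mem' := by
        rintro a b ⟨ha0, ha1, ha2⟩ ⟨hb0, hb1, hb2⟩
        refine ⟨V.add_mem ha0 hb0, fun X hX => ?_, fun X hX Y hY => ?_⟩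
        · rw [add_lie]; exact V.add_mem (ha1 X hX) (hb1 X hX)
        · rw [add_lie, add_lie]; exact V.add_mem (ha2 X hX Y hY) (hb2 X hX Y hY)
      smul_mem' := by
        rintro c a ⟨ha0, ha1, ha2⟩
        refine ⟨V.smul_mem c ha0, fun X hX => ?_, fun X hX Y hY => ?_⟩
        · rw [smul_lie]; exact V.smul_mem c (ha1 X hX)
        · rw [smul_lie, smul_lie]; exact V.smul_mem c (ha2 X hX Y hY) }
  have hstF : ∀ h ∈ H, ∀ v ∈ F, ⁅h, v⁆ ∈ F := by
    rintro h hh v ⟨hv0, hv1, hv2⟩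
    have hhq := hHq hh
    refine ⟨hstV h hh v hv0, fun X hX => ?_, fun X hX Y hY => ?_⟩
    · rw [lie_lie]
      exact V.sub_mem (hstV h hh _ (hv1 X hX)) (hv1 _ (q.lie_mem hhq hX))
    · rw [lie_lie h v X, sub_lie, lie_lie h ⁅v, X⁆ Y]
      exact V.sub_mem (V.sub_mem (hstV h hh _ (hv2 X hX Y hY)) (hv2 X hX _ (q.lie_mem hhq hY)))
        (hv2 _ (q.lie_mem hhq hX) Y hY)
  have hZF : Z ∈ F := ⟨h0, h1, h2⟩
  clear h0 h1 h2
  refine induction_of_cartan_stable hstF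
    (P := fun Z => ∀ X₁ ∈ q, ∀ X₂ ∈ q, ∀ X₃ ∈ q, ⁅⁅⁅Z, X₁⁆, X₂⁆, X₃⁆ ∈ V) (by simp)
    (fun x y hx hy X₁ h₁ X₂ h₂ X₃ h₃ => by
      simp only [add_lie]; exact V.add_mem (hx _ h₁ _ h₂ _ h₃) (hy _ h₁ _ h₂ _ h₃))
    (fun α Z hZF hZ => ?_) hZF
  obtain ⟨hZ0, hZ1, hZ2⟩ := hZF
  intro X₁ hX₁ X₂ hX₂ X₃ hX₃
  refine induction_of_cartan_stable hstq (P := fun X₁ => ⁅⁅⁅Z, X₁⁆, X₂⁆, X₃⁆ ∈ V) (by simp)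
    (fun x y hx hy => by simp only [lie_add, add_lie]; exact V.add_mem hx hy)
    (fun β₁ X₁ hX₁ hβ₁ => ?_) hX₁
  refine induction_of_cartan_stable hstq (P := fun X₂ => ⁅⁅⁅Z, X₁⁆, X₂⁆, X₃⁆ ∈ V) (by simp)
    (fun x y hx hy => by simp only [lie_add, add_lie]; exact V.add_mem hx hy)
    (fun β₂ X₂ hX₂ hβ₂ => ?_) hX₂
  refine induction_of_cartan_stable hstq (P := fun X₃ => ⁅⁅⁅Z, X₁⁆, X₂⁆, X₃⁆ ∈ V) (by simp)
    (fun x y hx hy => by simp only [lie_add]; exact V.add_mem hx hy)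
    (fun β₃ X₃ hX₃ hβ₃ => ?_) hX₃
  by_contra hT
  -- By the Jacobi identity, swapping neighbours costs a commutator of length 2 with entries in q,
  -- which lies in V.
  have swap₁ : ∀ {A B C : L}, A ∈ q → B ∈ q → C ∈ q → ⁅⁅⁅Z, A⁆, B⁆, C⁆ ∉ V →
      ⁅⁅⁅Z, B⁆, A⁆, C⁆ ∉ V := by
    intro A B C hA hB hC h h'
    apply h
    have e : ⁅⁅⁅Z, A⁆, B⁆, C⁆ = ⁅⁅⁅Z, B⁆, A⁆, C⁆ + ⁅⁅Z, ⁅A, B⁆⁆, C⁆ := by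
      rw [← add_lie]; congr 1; rw [leibniz_lie Z A B, ← lie_skew A ⁅Z, B⁆]; abel
    rw [e]
    exact V.add_mem h' (hZ2 _ (q.lie_mem hA hB) _ hC)
  have swap₂ : ∀ {A B C : L}, A ∈ q → B ∈ q → C ∈ q → ⁅⁅⁅Z, A⁆, B⁆, C⁆ ∉ V →
      ⁅⁅⁅Z, A⁆, C⁆, B⁆ ∉ V := by
    intro A B C hA hB hC h h'
    apply h
    have e : ⁅⁅⁅Z, A⁆, B⁆, C⁆ = ⁅⁅⁅Z, A⁆, C⁆, B⁆ + ⁅⁅Z, A⁆, ⁅B, C⁆⁆ := by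
      rw [leibniz_lie ⁅Z, A⁆ B C, ← lie_skew B ⁅⁅Z, A⁆, C⁆]; abel
    rw [e]
    exact V.add_mem h' (hZ2 _ hA _ (q.lie_mem hB hC))
  have last : ∀ {A B C : L}, A ∈ q → B ∈ q → C ∈ q → ⁅⁅⁅Z, A⁆, B⁆, C⁆ ∉ V →
      C ∉ q' ∧ ⁅⁅Z, A⁆, B⁆ ∉ q := by
    intro A B C hA hB hC h
    refine ⟨fun hC' => h ?_, fun h' => h (hqV (q.lie_mem h' hC))⟩
    -- An element C of q ∩ q' would preserve V = q + q'.
    obtain ⟨a, ha, b, hb, hab⟩ := Submodule.mem_sup.1 (hZ2 A hA B hB)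
    rw [← hab, add_lie]
    exact Submodule.add_mem_sup (q.lie_mem ha hC) (q'.lie_mem hb hC')
  have hT₁₃₂ := swap₂ hX₁ hX₂ hX₃ hT
  have hT₂₁₃ := swap₁ hX₁ hX₂ hX₃ hT
  have hT₃₁₂ := swap₁ hX₁ hX₃ hX₂ hT₁₃₂
  have hT₂₃₁ := swap₂ hX₂ hX₁ hX₃ hT₂₁₃
  obtain ⟨n₃, y₁₂⟩ := last hX₁ hX₂ hX₃ hT
  obtain ⟨n₂, y₃₁⟩ := last hX₃ hX₁ hX₂ hT₃₁₂
  obtain ⟨n₁, y₂₃⟩ := last hX₂ hX₃ hX₁ hT₂₃₁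
  have hnS : killingPerp q.toSubmodule ≤ S := le_sup_right.trans le_sup_left
  have hnS' : killingPerp q'.toSubmodule ≤ S := le_sup_right
  obtain ⟨sZ, s₁⟩ := mem_of_lie_lie_notMem hHq hHq' hS hnS hnS' hZ hβ₁ hβ₂ hX₁ hX₂ n₁ n₂
    (hZ1 _ hX₁) (hZ2 _ hX₁ _ hX₂) y₁₂
  obtain ⟨-, s₂⟩ := mem_of_lie_lie_notMem hHq hHq' hS hnS hnS' hZ hβ₂ hβ₃ hX₂ hX₃ n₂ n₃
    (hZ1 _ hX₂) (hZ2 _ hX₂ _ hX₃) y₂₃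
  obtain ⟨-, s₃⟩ := mem_of_lie_lie_notMem hHq hHq' hS hnS hnS' hZ hβ₃ hβ₁ hX₃ hX₁ n₃ n₁
    (hZ1 _ hX₃) (hZ2 _ hX₃ _ hX₁) y₃₁
  exact hT (hSV (hS _ (hS _ (hS _ sZ _ s₁) _ s₂) _ s₃))

end Core

/-! ### Borel subalgebras and Cartan's criterion -/

section MaximalSolvable

open LieAlgebra LieModule IsKilling

variable {L : Type*} [LieRing L] [LieAlgebra ℂ L]

/-- Supplies the one-dimensional enlargements of a Borel subalgebra to which maximality is applied.
-/
theorem LieSubalgebra.exists_toSubmodule_eq_sup_span (b : LieSubalgebra ℂ L) (x : L)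
    (h : ∀ y ∈ b, ⁅y, x⁆ ∈ b.toSubmodule ⊔ ℂ ∙ x) :
    ∃ s : LieSubalgebra ℂ L, s.toSubmodule = b.toSubmodule ⊔ ℂ ∙ x := by
  refine ⟨{ b.toSubmodule ⊔ ℂ ∙ x with lie_mem' := ?_ }, rfl⟩
  intro y z hy hz
  obtain ⟨y, hyb, u, hu, rfl⟩ := Submodule.mem_sup.1 hy
  obtain ⟨z, hzb, v, hv, rfl⟩ := Submodule.mem_sup.1 hz
  obtain ⟨c, rfl⟩ := Submodule.mem_span_singleton.1 hu
  obtain ⟨d, rfl⟩ := Submodule.mem_span_singleton.1 hv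
  change _ ∈ b.toSubmodule ⊔ ℂ ∙ x
  simp only [add_lie, lie_add, smul_lie, lie_smul, lie_self, smul_zero, add_zero]
  rw [← lie_skew x z]
  refine add_mem (add_mem ?_ (Submodule.smul_mem _ _ (neg_mem (h z hzb))))
    (Submodule.smul_mem _ _ (h y hyb))
  exact Submodule.mem_sup_left (b.lie_mem hyb hzb)

namespace IsBorel

variable {b : LieSubalgebra ℂ L}

theorem isSolvable (hb : IsBorel b) : IsSolvable b := hb.1

/-- A maximal solvable subalgebra is self-normalizing. -/
theorem mem_of_lie_mem (hb : IsBorel b) {x : L} (hx : ∀ y ∈ b, ⁅x, y⁆ ∈ b) : x ∈ b := by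
  have hx' : ∀ y ∈ b, ⁅y, x⁆ ∈ b := fun y hy => by
    rw [← lie_skew]; exact b.neg_mem (hx y hy)
  obtain ⟨s, hs⟩ := b.exists_toSubmodule_eq_sup_span x
    fun y hy => Submodule.mem_sup_left (hx' y hy)
  have hmem : ∀ y, y ∈ s ↔ y ∈ b.toSubmodule ⊔ ℂ ∙ x := fun y => by
    rw [← hs, LieSubalgebra.mem_toSubmodule]
  have hbs : b ≤ s := fun y hy => (hmem y).2 (Submodule.mem_sup_left hy)
  have := hb.isSolvable
  have hsol : IsSolvable s := by
    refine s.isSolvable_of_lie_mem b fun y hy z hz => ?_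
    replace hy := (hmem y).1 hy
    replace hz := (hmem z).1 hz
    obtain ⟨y, hyb, u, hu, rfl⟩ := Submodule.mem_sup.1 hy
    obtain ⟨z, hzb, v, hv, rfl⟩ := Submodule.mem_sup.1 hz
    obtain ⟨c, rfl⟩ := Submodule.mem_span_singleton.1 hu
    obtain ⟨d, rfl⟩ := Submodule.mem_span_singleton.1 hv
    simp only [add_lie, lie_add, smul_lie, lie_smul, lie_self, smul_zero, add_zero]
    exact b.add_mem (b.add_mem (b.lie_mem hyb hzb) (b.smul_mem _ (hx z hzb)))
      (b.smul_mem _ (hx' y hyb))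
  exact hb.2 hsol hbs ((hmem x).2 (Submodule.mem_sup_right (Submodule.mem_span_singleton_self x)))

end IsBorel

variable [FiniteDimensional ℂ L]

/-- Every solvable subalgebra is contained in a maximal solvable one. -/
theorem exists_isBorel_ge (s : LieSubalgebra ℂ L) [IsSolvable s] : ∃ b, IsBorel b ∧ s ≤ b := by
  obtain ⟨b, hb, hmax⟩ := (LieSubalgebra.wellFoundedGT_of_noetherian ℂ L).wf.has_min
    {t : LieSubalgebra ℂ L | IsSolvable t ∧ s ≤ t} ⟨s, ‹_›, le_rfl⟩
  exact ⟨b, ⟨hb.1, fun t ht hbt => by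
    by_contra h
    exact hmax t ⟨ht, hb.2.trans hbt⟩ (lt_of_le_not_ge hbt h)⟩, hb.2⟩

/-- In a solvable subalgebra, the `ad`-nilpotent elements are orthogonal to the subalgebra. -/
theorem killingForm_eq_zero_of_isNilpotent_ad (b : LieSubalgebra ℂ L) [IsSolvable b] {u z : L}
    (hu : u ∈ b) (hu' : _root_.IsNilpotent (ad ℂ L u)) (hz : z ∈ b) : killingForm ℂ L u z = 0 := by
  have h := LieModule.isNilpotent_toEnd_mul_of_isSolvable (L := b) L (u := ⟨u, hu⟩) hu' ⟨z, hz⟩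
  exact (LinearMap.isNilpotent_trace_of_isNilpotent h).eq_zero

/-- A solvable b is a solvable ideal of itself, so [b,b] acts nilpotently on the b-module L. -/
theorem isNilpotent_ad_lie_of_isSolvable (b : LieSubalgebra ℂ L) [IsSolvable b] {x y : L}
    (hx : x ∈ b) (hy : y ∈ b) : _root_.IsNilpotent (ad ℂ L ⁅x, y⁆) :=
  (⊤ : LieIdeal ℂ b).isNilpotent_toEnd_of_mem_top_lie L (x := ⁅(⟨x, hx⟩ : b), (⟨y, hy⟩ : b)⁆)
    (LieSubmodule.lie_mem_lie (LieSubmodule.mem_top _) (LieSubmodule.mem_top _))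

theorem killingForm_lie_eq_zero_of_isSolvable (b : LieSubalgebra ℂ L) [IsSolvable b] {x y z : L}
    (hx : x ∈ b) (hy : y ∈ b) (hz : z ∈ b) : killingForm ℂ L ⁅x, y⁆ z = 0 :=
  killingForm_eq_zero_of_isNilpotent_ad b (b.lie_mem hx hy)
    (isNilpotent_ad_lie_of_isSolvable b hx hy) hz

/-- Cartan's criterion for a subalgebra. -/
theorem isSolvable_of_killingForm_lie_eq_zero (s : LieSubalgebra ℂ L)
    (h : ∀ x ∈ s, ∀ y ∈ s, ∀ z ∈ s, killingForm ℂ L ⁅x, y⁆ z = 0) : IsSolvable s := by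
  have htr : traceForm ℂ (derivedSeries ℂ s 1) L = 0 := by
    ext ⟨x, hx⟩ ⟨y, hy⟩
    change killingForm ℂ L (x : L) (y : L) = 0
    have hx' : x ∈ Submodule.span ℂ {⁅x, y⁆ | (x : s) (y : s)} := by
      rw [← coe_derivedSeries_one_eq ℂ s]; exact hx
    clear hx
    induction hx' using Submodule.span_induction with
    | mem x hx => obtain ⟨u, v, rfl⟩ := hx; exact h _ u.2 _ v.2 _ y.2
    | zero => simp
    | add u v _ _ hu hv =>
      change killingForm ℂ L ((u : L) + (v : L)) y = 0
      rw [map_add, LinearMap.add_apply, hu, hv, add_zero]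
    | smul c u _ hu =>
      change killingForm ℂ L (c • (u : L)) y = 0
      rw [map_smul, LinearMap.smul_apply, hu, smul_zero]
  have hnil := isNilpotent_derivedSeries_of_traceForm_eq_zero htr
  -- The second derived algebra acts nilpotently on L and sits in L as a submodule, so it is a
  -- nilpotent Lie algebra.
  let g : derivedSeries ℂ (derivedSeries ℂ s 1) 1 →ₗ[ℂ] L :=
    s.toSubmodule.subtype ∘ₗ (derivedSeries ℂ s 1).toSubmodule.subtype ∘ₗ
      (derivedSeries ℂ (derivedSeries ℂ s 1) 1).toSubmodule.subtype
  have hg : Function.Injective g := fun x y hxy => Subtype.ext (Subtype.ext (Subtype.ext hxy))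
  have hnil' : LieRing.IsNilpotent (derivedSeries ℂ (derivedSeries ℂ s 1) 1) :=
    hg.lieModuleIsNilpotent (f := (LieHom.id : derivedSeries ℂ (derivedSeries ℂ s 1) 1 →ₗ⁅ℂ⁆ _))
      (g := g) (fun _ _ => rfl)
  have := isSolvable_of_derivedSeries_one ℂ (derivedSeries ℂ s 1)
  exact isSolvable_of_derivedSeries_one ℂ s

/-- A maximal solvable subalgebra contains its orthogonal. -/
theorem IsBorel.killingPerp_le {b : LieSubalgebra ℂ L} (hb : IsBorel b) :
    killingPerp b.toSubmodule ≤ b.toSubmodule := by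
  have := hb.isSolvable
  let P : LieSubmodule ℂ b L :=
    { killingPerp b.toSubmodule with
      lie_mem := fun {y v} hv => lie_mem_killingPerp (fun w hw => b.lie_mem y.2 hw) hv }
  -- If b^⊥ is not inside b, Lie's theorem on its nonzero image in L/b gives v ∈ b^⊥ outside b with
  -- [b,v] ⊆ b + ℂv.
  let Q : LieSubmodule ℂ b (L ⧸ b.toLieSubmodule) := P.map (LieSubmodule.Quotient.mk' _)
  by_contra hle
  have hQ : Nontrivial Q := by
    obtain ⟨v, hv, hvb⟩ := SetLike.not_le_iff_exists.1 hle
    refine nontrivial_of_ne (⟨LieSubmodule.Quotient.mk' _ v,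
      LieSubmodule.mem_map_of_mem (N := P) hv⟩ : Q) 0 fun h => hvb ?_
    exact (LieSubmodule.Quotient.mk_eq_zero (N := b.toLieSubmodule)).1 (congrArg Subtype.val h)
  obtain ⟨χ, W, -, hW, hχ⟩ := exists_lieSubmodule_smul_of_isSolvable (L := b) Q
  obtain ⟨⟨⟨w, hw⟩, hwW⟩, hw0⟩ := @exists_ne W ((LieSubmodule.nontrivial_iff_ne_bot ℂ b Q).2 hW) 0
  obtain ⟨v, hv, rfl⟩ := (LieSubmodule.mem_map _).1 hw
  have hvb : v ∉ b := fun h => hw0 (Subtype.ext (Subtype.ext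
    ((LieSubmodule.Quotient.mk_eq_zero (N := b.toLieSubmodule)).2 h)))
  have hlie : ∀ y (hy : y ∈ b), ⁅y, v⁆ - χ ⟨y, hy⟩ • v ∈ b := by
    intro y hy
    have h := congrArg Subtype.val (hχ _ hwW ⟨y, hy⟩)
    refine (LieSubmodule.Quotient.mk_eq_zero (N := b.toLieSubmodule)).1 ?_
    exact (map_sub (LieSubmodule.Quotient.mk' b.toLieSubmodule) _ _).trans (sub_eq_zero.2 h)
  obtain ⟨s, hs⟩ := b.exists_toSubmodule_eq_sup_span v fun y hy => by
    rw [← sub_add_cancel ⁅y, v⁆ (χ ⟨y, hy⟩ • v)]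
    exact Submodule.add_mem_sup (hlie y hy)
      (Submodule.smul_mem _ _ (Submodule.mem_span_singleton_self v))
  have hmem : ∀ y, y ∈ s ↔ y ∈ b.toSubmodule ⊔ ℂ ∙ v := fun y => by
    rw [← hs, LieSubalgebra.mem_toSubmodule]
  have hbs : b ≤ s := fun y hy => (hmem y).2 (Submodule.mem_sup_left hy)
  have hvκ : ∀ y ∈ b, killingForm ℂ L v y = 0 := mem_killingPerp.1 hv
  have hvκ' : ∀ y ∈ b, killingForm ℂ L y v = 0 := fun y hy => by
    rw [LieModule.traceForm_comm]; exact hvκ y hy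
  -- Cartan's criterion applies to b + ℂv: the terms involving v vanish because v ⊥ b and κ([v,p],v)
  -- = -κ(p,[v,v]) = 0.
  have hsol : IsSolvable s := by
    refine isSolvable_of_killingForm_lie_eq_zero s fun x hx y hy z hz => ?_
    replace hx := (hmem x).1 hx
    replace hy := (hmem y).1 hy
    replace hz := (hmem z).1 hz
    obtain ⟨x, hxb, u, hu, rfl⟩ := Submodule.mem_sup.1 hx
    obtain ⟨y, hyb, u', hu', rfl⟩ := Submodule.mem_sup.1 hy
    obtain ⟨z, hzb, u'', hu'', rfl⟩ := Submodule.mem_sup.1 hz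
    obtain ⟨c, rfl⟩ := Submodule.mem_span_singleton.1 hu
    obtain ⟨d, rfl⟩ := Submodule.mem_span_singleton.1 hu'
    obtain ⟨e, rfl⟩ := Submodule.mem_span_singleton.1 hu''
    have h1 := killingForm_lie_eq_zero_of_isSolvable b hxb hyb hzb
    have h2 : killingForm ℂ L ⁅x, y⁆ v = 0 := hvκ' _ (b.lie_mem hxb hyb)
    have h3 : ∀ p ∈ b, ∀ r ∈ b, killingForm ℂ L ⁅v, p⁆ r = 0 := fun p hp r hr => by
      rw [LieModule.traceForm_apply_lie_apply]; exact hvκ _ (b.lie_mem hp hr)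
    have h4 : ∀ p ∈ b, killingForm ℂ L ⁅v, p⁆ v = 0 := fun p hp => by
      rw [killingForm_lie_left, lie_self, map_zero, neg_zero]
    have h5 : ∀ p, killingForm ℂ L ⁅p, v⁆ = - killingForm ℂ L ⁅v, p⁆ := fun p => by
      rw [← lie_skew, map_neg]
    simp [h1, h2, h3 y hyb z hzb, h3 x hxb z hzb, h4 y hyb, h4 x hxb, h5]
  exact hvb (hb.2 hsol hbs
    ((hmem v).2 (Submodule.mem_sup_right (Submodule.mem_span_singleton_self v))))

end MaximalSolvable

/-! ### Nilpotency of the orthogonal of a Borel subalgebra -/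

section AdNilpotent

open LieAlgebra LieModule IsKilling Polynomial ComplexConjugate

/-- There is a polynomial in an endomorphism `f` acting on each generalized eigenspace of `f` by the
complex conjugate of the eigenvalue; if its product with `f` has trace zero, then `f` is
nilpotent. -/
theorem Module.End.exists_aeval_eq_conj_smul {V : Type*} [AddCommGroup V] [Module ℂ V]
    [FiniteDimensional ℂ V] (f : Module.End ℂ V) :
    ∃ P : ℂ[X], (∀ a, ∀ v ∈ f.maxGenEigenspace a, aeval f P v = conj a • v) ∧
      (LinearMap.trace ℂ V (f * aeval f P) = 0 → _root_.IsNilpotent f) := by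
  obtain ⟨n, hn, s, hs, hnil, hss, hf⟩ := f.exists_isNilpotent_isSemisimple
  obtain ⟨p, hp⟩ := Algebra.adjoin_mem_exists_aeval ℂ f hs
  let T := (finite_hasEigenvalue s).toFinset
  -- The semisimple part is s = p(f), and r interpolates conjugation on its eigenvalues, so r ∘ p is
  -- the required polynomial.
  let r : ℂ[X] := Lagrange.interpolate T id (fun a => conj a)
  have hfs : Commute f s := Algebra.commute_of_mem_adjoin_self hs
  have hfn : Commute f n := Algebra.commute_of_mem_adjoin_self hn
  have hsv : ∀ a, ∀ v ∈ f.maxGenEigenspace a, s v = a • v := fun a v hv =>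
    apply_eq_of_mem_of_comm_of_isFinitelySemisimple_of_isNil hv hfs hss.isFinitelySemisimple
      (by rw [hf, add_sub_cancel_right]; exact hnil)
  have hD : ∀ a, ∀ v ∈ f.maxGenEigenspace a, aeval f (r.comp p) v = conj a • v := by
    intro a v hv
    rcases eq_or_ne v 0 with rfl | hv0
    · simp
    have ha : a ∈ T := (finite_hasEigenvalue s).mem_toFinset.2
      (hasEigenvalue_of_hasEigenvector ⟨mem_eigenspace_iff.2 (hsv a v hv), hv0⟩)
    rw [aeval_comp, hp, aeval_apply_of_mem_apply_eq_smul (hsv a v hv)]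
    congr 1
    exact Lagrange.eval_interpolate_at_node (v := id) _ Function.injective_id.injOn ha
  refine ⟨r.comp p, hD, fun htr => ?_⟩
  set D := aeval f (r.comp p) with hDdef
  have hnD : Commute n D := by
    refine Algebra.commute_of_mem_adjoin_singleton_of_commute (R := ℂ) ?_ hfn.symm
    exact Polynomial.aeval_mem_adjoin_singleton _ _
  have htr' : LinearMap.trace ℂ V (s * D) = 0 := by
    rw [hf, add_mul, map_add, (LinearMap.isNilpotent_trace_of_isNilpotent
      (hnD.isNilpotent_mul_right hnil)).eq_zero, zero_add] at htr
    exact htr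
  classical
  have hint := DirectSum.isInternal_submodule_of_iSupIndep_of_iSup_eq_top
    f.independent_maxGenEigenspace f.iSup_maxGenEigenspace_eq_top
  have hfin : {a | f.maxGenEigenspace a ≠ ⊥}.Finite :=
    WellFoundedGT.finite_ne_bot_of_iSupIndep f.independent_maxGenEigenspace
  have hsD : ∀ a, ∀ v ∈ f.maxGenEigenspace a, (s * D) v = (a * conj a) • v := fun a v hv => by
    rw [Module.End.mul_apply, hD a v hv, map_smul, hsv a v hv, smul_smul, mul_comm]
  have hmaps : ∀ a, Set.MapsTo (s * D) (f.maxGenEigenspace a) (f.maxGenEigenspace a) :=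
    fun a v hv => by
      rw [SetLike.mem_coe, hsD a v hv]; exact Submodule.smul_mem _ _ hv
  -- The trace is the sum of |a|² times the dimension of the a-th generalized eigenspace; its
  -- vanishing leaves only a = 0.
  rw [LinearMap.trace_eq_sum_trace_restrict' hint hfin hmaps] at htr'
  have hres : ∀ a, LinearMap.trace ℂ _ ((s * D).restrict (hmaps a)) =
      ((Complex.normSq a * Module.finrank ℂ (f.maxGenEigenspace a) : ℝ) : ℂ) := by
    intro a
    have : (s * D).restrict (hmaps a) = (a * conj a) • LinearMap.id := by
      ext v
      exact hsD a v v.2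
    rw [this, map_smul, LinearMap.trace_id, Complex.mul_conj, smul_eq_mul]
    push_cast
    rfl
  simp_rw [hres] at htr'
  rw [← Complex.ofReal_sum, Complex.ofReal_eq_zero, Finset.sum_eq_zero_iff_of_nonneg
    (fun a _ => mul_nonneg (Complex.normSq_nonneg a) (Nat.cast_nonneg _))] at htr'
  have hbot : ∀ a, a ≠ 0 → f.maxGenEigenspace a = ⊥ := by
    intro a ha
    by_contra h
    have h0 := htr' a (hfin.mem_toFinset.2 h)
    rw [mul_eq_zero, Complex.normSq_eq_zero, Nat.cast_eq_zero, Submodule.finrank_eq_zero] at h0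
    exact h0.elim ha h
  have htop : f.maxGenEigenspace 0 = ⊤ := by
    rw [eq_top_iff, ← f.iSup_maxGenEigenspace_eq_top]
    refine iSup_le fun a => ?_
    rcases eq_or_ne a 0 with rfl | ha
    · exact le_rfl
    · rw [hbot a ha]; exact bot_le
  rw [Module.End.isNilpotent_iff_of_finite]
  intro v
  have hv : v ∈ f.maxGenEigenspace 0 := htop ▸ Submodule.mem_top
  simpa using (f.mem_maxGenEigenspace 0 v).1 hv

variable {L : Type*} [LieRing L] [LieAlgebra ℂ L] [FiniteDimensional ℂ L] [IsKilling ℂ L]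

/-- The elements of a maximal solvable subalgebra that are orthogonal to it are `ad`-nilpotent. -/
theorem IsBorel.isNilpotent_ad {b : LieSubalgebra ℂ L} (hb : IsBorel b) {x : L}
    (hx : x ∈ killingPerp b.toSubmodule) : _root_.IsNilpotent (ad ℂ L x) := by
  obtain ⟨P, hP, hnil⟩ := (ad ℂ L x).exists_aeval_eq_conj_smul
  apply hnil
  set D := aeval (ad ℂ L x) P
  -- D is a derivation because conjugation is additive and brackets add generalized eigenvalues.
  -- Hence D = `ad z`; z normalizes b, so z ∈ b, and x ⊥ z is the trace condition.
  have hder : ∀ y z : L, D ⁅y, z⁆ = ⁅D y, z⁆ + ⁅y, D z⁆ := by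
    intro y z
    have hy : y ∈ ⨆ a, (ad ℂ L x).maxGenEigenspace a := by
      rw [Module.End.iSup_maxGenEigenspace_eq_top]; exact Submodule.mem_top
    have hz : z ∈ ⨆ a, (ad ℂ L x).maxGenEigenspace a := by
      rw [Module.End.iSup_maxGenEigenspace_eq_top]; exact Submodule.mem_top
    induction hy using Submodule.iSup_induction' with
    | mem a y hy =>
      induction hz using Submodule.iSup_induction' with
      | mem c z hz =>
        rw [hP a y hy, hP c z hz, hP (a + c) ⁅y, z⁆ (lie_mem_maxGenEigenspace_toEnd hy hz),
          smul_lie, lie_smul, ← add_smul, map_add]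
      | zero => simp
      | add _ _ _ _ h h' => simp only [lie_add, map_add, h, h']; abel
    | zero => simp
    | add _ _ _ _ h h' => simp only [add_lie, map_add, h, h']; abel
  let D' : LieDerivation ℂ L L := ⟨D, fun y z => by rw [hder, ← lie_skew (D y) z]; abel⟩
  obtain ⟨z, hz⟩ := LieDerivation.IsKilling.exists_eq_ad D'
  have hDz : ∀ y, ⁅z, y⁆ = D y := fun y => by
    have := congrArg (fun E : LieDerivation ℂ L L => E y) hz
    simpa [D'] using this
  have hxb : x ∈ b := hb.killingPerp_le hx
  have hzb : z ∈ b := hb.mem_of_lie_mem fun y hy => by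
    rw [hDz]
    exact Polynomial.aeval_apply_smul_mem_of_le_comap (q := b.toSubmodule) hy P (ad ℂ L x)
      (fun w hw => b.lie_mem hxb hw)
  have had : ad ℂ L z = D := LinearMap.ext hDz
  have := mem_killingPerp.1 hx z hzb
  rwa [killingForm_apply_apply, had] at this

end AdNilpotent

/-! ### A Cartan subalgebra common to two Borel subalgebras -/

section CommonCartan

open LieAlgebra LieModule IsKilling LieSubalgebra

variable {L : Type*} [LieRing L] [LieAlgebra ℂ L] [FiniteDimensional ℂ L] [IsKilling ℂ L]

/-- If `x ∈ q` and no nonzero element of the orthogonal of `q` is annihilated by a power of `ad x`,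
then the Engel subalgebra of `x` is contained in `q`. -/
theorem LieSubalgebra.engel_le_of_killingPerp {q : LieSubalgebra ℂ L} {x : L} (hx : x ∈ q)
    (h : ∀ y ∈ killingPerp q.toSubmodule, ⁅x, y⁆ = 0 → y = 0) : engel ℂ x ≤ q := by
  let f : Module.End ℂ (killingPerp q.toSubmodule) :=
    (ad ℂ L x).restrict fun y hy => lie_mem_killingPerp (fun v hv => q.lie_mem hx hv) hy
  have hf : Function.Injective f := by
    rw [injective_iff_map_eq_zero]
    intro y hy
    exact Subtype.ext (h y y.2 (congrArg Subtype.val hy))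
  have hf' : Function.Surjective f := LinearMap.injective_iff_surjective.1 hf
  intro y hy
  obtain ⟨n, hn⟩ := (mem_engel_iff ℂ x y).1 hy
  clear hy
  -- As q = q^⊥⊥, orthogonality to q^⊥ suffices. Each v there is [x,w] with w ∈ q^⊥, and moving `ad
  -- x` to y lowers the exponent n.
  rw [← LieSubalgebra.mem_toSubmodule, ← killingPerp_killingPerp q.toSubmodule, mem_killingPerp]
  induction n generalizing y with
  | zero => intro v _; rw [show y = 0 from hn, map_zero, LinearMap.zero_apply]
  | succ n ih =>
    intro v hv
    obtain ⟨w, hw⟩ := hf' ⟨v, hv⟩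
    have hw' : ⁅x, (w : L)⁆ = v := congrArg Subtype.val hw
    have := ih (y := ⁅x, y⁆) (by rw [pow_succ] at hn; exact hn) w w.2
    rw [killingForm_lie_left, neg_eq_zero, hw'] at this
    exact this

variable {H b c : LieSubalgebra ℂ L}

omit [IsKilling ℂ L] in
/-- An `ad`-nilpotent element of a maximal solvable subalgebra is orthogonal to it. -/
theorem IsBorel.mem_killingPerp_of_isNilpotent (hb : IsBorel b) {x : L} (hx : x ∈ b)
    (hx' : _root_.IsNilpotent (ad ℂ L x)) : x ∈ killingPerp b.toSubmodule := by
  have := hb.isSolvable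
  exact mem_killingPerp.2 fun z hz => killingForm_eq_zero_of_isNilpotent_ad b hx hx' hz

/-- By duality, H ⊆ c + b^⊥ amounts to c^⊥ ∩ b ⊆ H^⊥. Elements of c^⊥ are `ad`-nilpotent, so those
in b lie in b^⊥ ⊆ H^⊥. -/
theorem IsBorel.exists_add_mem (hb : IsBorel b) (hH : H ≤ b) (hc : IsBorel c) {h : L} (hh : h ∈ H) :
    ∃ u ∈ killingPerp b.toSubmodule, h + u ∈ c := by
  have hle : H.toSubmodule ≤ c.toSubmodule ⊔ killingPerp b.toSubmodule := by
    rw [← killingPerp_killingPerp H.toSubmodule,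
      ← killingPerp_killingPerp (c.toSubmodule ⊔ killingPerp b.toSubmodule)]
    refine killingPerp_anti ?_
    rw [killingPerp_sup, killingPerp_killingPerp]
    rintro y ⟨hyc, hyb⟩
    have := hb.mem_killingPerp_of_isNilpotent hyb (hc.isNilpotent_ad hyc)
    exact killingPerp_anti hH this
  obtain ⟨y, hy, u, hu, hyu⟩ := Submodule.mem_sup.1 (hle hh)
  exact ⟨-u, Submodule.neg_mem _ hu, by rw [← hyu, add_neg_cancel_right]; exact hy⟩

omit [IsKilling ℂ L] in
theorem LieSubalgebra.exists_forall_weight_ne_zero (H : LieSubalgebra ℂ L) [H.IsCartanSubalgebra] :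
    ∃ h : H, ∀ α : Weight ℂ H L, α.IsNonZero → α h ≠ 0 := by
  obtain ⟨h, hh⟩ := Module.Dual.exists_forall_ne_zero_of_forall_exists
    (fun α : {α : Weight ℂ H L // α.IsNonZero} => α.1.toLinear) fun α => by
      obtain ⟨h, hh⟩ := Function.ne_iff.1 α.2
      exact ⟨h, hh⟩
  exact ⟨h, fun α hα => hh ⟨α, hα⟩⟩

/-- The adjoint action of a regular element of a Cartan subalgebra contained in a maximal solvable
subalgebra is injective on the orthogonal of the latter. -/
theorem IsBorel.exists_lie_ne_zero [H.IsCartanSubalgebra] (hb : IsBorel b) (hH : H ≤ b) :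
    ∃ h ∈ H, ∀ y ∈ killingPerp b.toSubmodule, ⁅h, y⁆ = 0 → y = 0 := by
  obtain ⟨h, hh⟩ := H.exists_forall_weight_ne_zero
  refine ⟨h, h.2, ?_⟩
  have hst : ∀ x ∈ H, ∀ y ∈ killingPerp b.toSubmodule, ⁅x, y⁆ ∈ killingPerp b.toSubmodule :=
    fun x hx y hy => lie_mem_killingPerp (fun v hv => b.lie_mem (hH hx) hv) hy
  let f : Module.End ℂ (killingPerp b.toSubmodule) :=
    (ad ℂ L h).restrict (hst h h.2)
  have hf : Function.Surjective f := by
    rintro ⟨v, hv⟩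
    suffices ∃ w ∈ killingPerp b.toSubmodule, ⁅(h : L), w⁆ = v by
      obtain ⟨w, hw, hwv⟩ := this
      exact ⟨⟨w, hw⟩, Subtype.ext hwv⟩
    refine induction_of_cartan_stable (H := H) hst
      (P := fun v => ∃ w ∈ killingPerp b.toSubmodule, ⁅(h : L), w⁆ = v)
      ⟨0, Submodule.zero_mem _, lie_zero _⟩ ?_ ?_ hv
    · rintro _ _ ⟨w, hw, rfl⟩ ⟨w', hw', rfl⟩
      exact ⟨_, Submodule.add_mem _ hw hw', lie_add _ _ _⟩
    · intro α v hv hvα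
      by_cases hv0 : v = 0
      · exact ⟨0, Submodule.zero_mem _, by rw [lie_zero, hv0]⟩
      by_cases hα : α = 0
      -- A vector of weight 0 in b^⊥ is an `ad`-nilpotent element of H, hence zero.
      · subst hα
        exact absurd (eq_zero_of_isNilpotent_ad_of_mem_isCartanSubalgebra ℂ L H
          (mem_cartan_of_mem_rootSpace_zero hvα) (hb.isNilpotent_ad hv)) hv0
      · have hne : rootSpace H α ≠ ⊥ := fun h => hv0 (by rw [h] at hvα; exact hvα)
        have h0 : α h ≠ 0 := hh ⟨α, hne⟩ hα
        have hhv : ⁅(h : L), v⁆ = α h • v := lie_eq_smul_of_mem_rootSpace hvα h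
        exact ⟨(α h)⁻¹ • v, Submodule.smul_mem _ _ hv, by
          rw [lie_smul, hhv, inv_smul_smul₀ h0]⟩
  intro y hy hy0
  have := LinearMap.injective_iff_surjective.2 hf (a₁ := ⟨y, hy⟩) (a₂ := 0) (Subtype.ext (by
    rw [map_zero]; exact hy0))
  exact congrArg Subtype.val this

/-- Perturb a regular h ∈ H by u ∈ b^⊥ so that x = h + u ∈ b ∩ c. By Lie's theorem `ad x` stays
injective on b^⊥, so the Engel subalgebra E of x lies in b and meets b^⊥ in 0. An element of c^⊥
killed by `ad x` is an `ad`-nilpotent element of b, hence in E ∩ b^⊥ = 0; so E ⊆ c. Finally [E,E] ⊆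
E ∩ b^⊥ = 0, and Engel subalgebras are self-normalizing. -/
theorem IsBorel.exists_isCartanSubalgebra_le_of_le [H.IsCartanSubalgebra] (hb : IsBorel b)
    (hH : H ≤ b) (hc : IsBorel c) : ∃ E : LieSubalgebra ℂ L, E.IsCartanSubalgebra ∧ E ≤ b ∧ E ≤ c := by
  have hbs := hb.isSolvable
  obtain ⟨h, hhH, hh⟩ := hb.exists_lie_ne_zero hH
  obtain ⟨u, hu, huc⟩ := hb.exists_add_mem hH hc hhH
  have hub : u ∈ b := hb.killingPerp_le hu
  let N : LieSubmodule ℂ b L :=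
    { killingPerp b.toSubmodule with
      lie_mem := fun {y v} hv => lie_mem_killingPerp (fun w hw => b.lie_mem y.2 hw) hv }
  have hinj : ∀ y ∈ killingPerp b.toSubmodule, ⁅h + u, y⁆ = 0 → y = 0 := by
    intro y hy hy0
    have hnil : _root_.IsNilpotent (toEnd ℂ b N ⟨u, hub⟩) := by
      obtain ⟨k, hk⟩ := hb.isNilpotent_ad hu
      refine ⟨k, LinearMap.ext fun v => Subtype.ext ?_⟩
      have : ∀ j, (((toEnd ℂ b N ⟨u, hub⟩) ^ j) v : L) = ((ad ℂ L u) ^ j) v := by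
        intro j
        induction j with
        | zero => rfl
        | succ j ih =>
          rw [pow_succ', pow_succ', Module.End.mul_apply, Module.End.mul_apply, ← ih]; rfl
      rw [this, hk]; rfl
    have hz : Function.Injective (toEnd ℂ b N ⟨h, hH hhH⟩) := by
      rw [injective_iff_map_eq_zero]
      intro v hv
      exact Subtype.ext (hh v v.2 (congrArg Subtype.val hv))
    have := LieModule.eq_zero_of_lie_add_eq_zero_of_isSolvable N hnil hz (m := ⟨y, hy⟩)
      (Subtype.ext hy0)
    exact congrArg Subtype.val this
  have hxb : h + u ∈ b := b.add_mem (hH hhH) hub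
  have hEb : engel ℂ (h + u) ≤ b := engel_le_of_killingPerp hxb hinj
  have hEN : ∀ y ∈ engel ℂ (h + u), y ∈ killingPerp b.toSubmodule → y = 0 := by
    intro y hy hyN
    obtain ⟨n, hn⟩ := (mem_engel_iff ℂ _ y).1 hy
    clear hy
    induction n generalizing y with
    | zero => exact hn
    | succ n ih =>
      refine hinj y hyN (ih ⁅h + u, y⁆
        (lie_mem_killingPerp (fun v hv => b.lie_mem hxb hv) hyN) ?_)
      rw [pow_succ] at hn
      exact hn
  have hEc : engel ℂ (h + u) ≤ c := by
    refine engel_le_of_killingPerp huc fun y hy hy0 => ?_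
    have hyE : y ∈ engel ℂ (h + u) := (mem_engel_iff ℂ _ y).2 ⟨1, by rw [pow_one]; exact hy0⟩
    exact hEN y hyE (hb.mem_killingPerp_of_isNilpotent (hEb hyE) (hc.isNilpotent_ad hy))
  have hab : IsLieAbelian (engel ℂ (h + u)) := ⟨fun x y => Subtype.ext (hEN _
    (⁅x, y⁆ : engel ℂ (h + u)).2 (mem_killingPerp.2 fun z hz =>
      killingForm_lie_eq_zero_of_isSolvable b (hEb x.2) (hEb y.2) hz))⟩
  exact ⟨_, ⟨inferInstance, normalizer_engel ℂ _⟩, hEb, hEc⟩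

/-- Any two maximal solvable subalgebras contain a common Cartan subalgebra. -/
theorem IsBorel.exists_isCartanSubalgebra_le (hb : IsBorel b) (hc : IsBorel c) :
    ∃ E : LieSubalgebra ℂ L, E.IsCartanSubalgebra ∧ E ≤ b ∧ E ≤ c := by
  -- An auxiliary Borel subalgebra d containing a Cartan subalgebra first transfers one to b.
  obtain ⟨x, hx⟩ := exists_isCartanSubalgebra_engel (K := ℂ) (L := L)
  obtain ⟨d, hd, hHd⟩ := exists_isBorel_ge (engel ℂ x)
  obtain ⟨E, hE, -, hEb⟩ := hd.exists_isCartanSubalgebra_le_of_le hHd hb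
  exact hb.exists_isCartanSubalgebra_le_of_le hEb hc

end CommonCartan

/-! ### Borel subalgebras under maps with solvable kernel -/

section SurjectiveHom

open LieAlgebra LieModule LieSubalgebra

variable {G L : Type*} [LieRing G] [LieAlgebra ℂ G] [LieRing L] [LieAlgebra ℂ L]

/-- A morphism of Lie algebras restricted to a subalgebra, with values in the image. -/
def LieSubalgebra.mapHom (f : G →ₗ⁅ℂ⁆ L) (q : LieSubalgebra ℂ G) : q →ₗ⁅ℂ⁆ q.map f where
  toFun x := ⟨f x, (mem_map f q _).2 ⟨x, x.2, rfl⟩⟩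
  map_add' x y := Subtype.ext (map_add f (x : G) y)
  map_smul' c x := Subtype.ext (map_smul f c (x : G))
  map_lie' {x y} := Subtype.ext (f.map_lie (x : G) y)

theorem LieSubalgebra.mapHom_surjective (f : G →ₗ⁅ℂ⁆ L) (q : LieSubalgebra ℂ G) :
    Function.Surjective (q.mapHom f) := by
  rintro ⟨x, hx⟩
  obtain ⟨y, hy, rfl⟩ := (mem_map f q x).1 hx
  exact ⟨⟨y, hy⟩, rfl⟩

theorem LieSubalgebra.isSolvable_map (f : G →ₗ⁅ℂ⁆ L) (q : LieSubalgebra ℂ G) [IsSolvable q] :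
    IsSolvable (q.map f) :=
  (q.mapHom_surjective f).lieAlgebra_isSolvable

theorem LieSubalgebra.isSolvable_comap (f : G →ₗ⁅ℂ⁆ L) [IsSolvable f.ker] (t : LieSubalgebra ℂ L)
    [IsSolvable t] : IsSolvable (t.comap f) := by
  let g : t.comap f →ₗ⁅ℂ⁆ t :=
    { toFun := fun x => ⟨f x, x.2⟩
      map_add' := fun x y => Subtype.ext (map_add f (x : G) y)
      map_smul' := fun c x => Subtype.ext (map_smul f c (x : G))
      map_lie' := fun {x y} => Subtype.ext (f.map_lie (x : G) y) }
  let k : g.ker →ₗ⁅ℂ⁆ f.ker :=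
    { toFun := fun x => ⟨x.1.1, f.mem_ker.2 (congrArg Subtype.val (g.mem_ker.1 x.2))⟩
      map_add' := fun _ _ => rfl
      map_smul' := fun _ _ => rfl
      map_lie' := rfl }
  have hk : Function.Injective k := fun x y h =>
    Subtype.ext (Subtype.ext (congrArg (fun z : f.ker => (z : G)) h))
  have : IsSolvable g.ker := hk.lieAlgebra_isSolvable
  exact g.isSolvable_of_ker

variable {f : G →ₗ⁅ℂ⁆ L} [IsSolvable f.ker] {b q : LieSubalgebra ℂ G}

/-- A solvable kernel keeps the preimage of a solvable algebra solvable, so maximality applies. -/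
theorem IsBorel.comap_map_le (hb : IsBorel b) : (b.map f).comap f ≤ b := by
  have := hb.isSolvable
  have := b.isSolvable_map f
  exact hb.2 ((b.map f).isSolvable_comap f) fun x hx => (mem_map f b _).2 ⟨x, hx, rfl⟩

theorem IsBorel.mem_of_map_mem (hb : IsBorel b) {x : G} (hx : f x ∈ b.map f) : x ∈ b :=
  hb.comap_map_le hx

theorem IsBorel.ker_le (hb : IsBorel b) {x : G} (hx : f x = 0) : x ∈ b :=
  hb.mem_of_map_mem (f := f) (by rw [hx]; exact (b.map f).zero_mem)

theorem IsBorel.map (hb : IsBorel b) (hf : Function.Surjective f) : IsBorel (b.map f) := by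
  have := hb.isSolvable
  refine ⟨b.isSolvable_map f, fun t ht hbt x hx => ?_⟩
  have := ht
  obtain ⟨y, rfl⟩ := hf x
  exact (mem_map f b _).2 ⟨y, hb.2 (t.isSolvable_comap f)
    (fun z hz => hbt ((mem_map f b _).2 ⟨z, hz, rfl⟩)) hx, rfl⟩

end SurjectiveHom

/-! ### The nilradical of a parabolic subalgebra -/

section Nilradical

open LieAlgebra LieModule LieSubalgebra IsKilling

section Killing

variable {L : Type*} [LieRing L] [LieAlgebra ℂ L] [FiniteDimensional ℂ L]

theorem LieIdeal.isNilpotent_ad_of_isNilpotent {L : Type*} [LieRing L] [LieAlgebra ℂ L]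
    (I : LieIdeal ℂ L) [LieRing.IsNilpotent I] {x : L} (hx : x ∈ I) :
    _root_.IsNilpotent (ad ℂ L x) := by
  obtain ⟨k, hk⟩ := LieModule.isNilpotent_toEnd_of_isNilpotent ℂ I I ⟨x, hx⟩
  have h : ∀ j (y : I), (((toEnd ℂ I I ⟨x, hx⟩) ^ j) y : L) = ((ad ℂ L x) ^ j) y := by
    intro j y
    induction j with
    | zero => rfl
    | succ j ih =>
      rw [pow_succ', pow_succ', Module.End.mul_apply, Module.End.mul_apply, ← ih]; rfl
  refine ⟨k + 1, LinearMap.ext fun y => ?_⟩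
  rw [pow_succ, Module.End.mul_apply]
  have := h k ⟨⁅x, y⁆, lie_mem_left ℂ L I x y hx⟩
  rw [hk] at this
  exact this.symm

variable {b q : LieSubalgebra ℂ L}

omit [FiniteDimensional ℂ L] in
/-- If `q` contains its orthogonal, an element of `q` acting nilpotently on `q` is
`ad`-nilpotent. -/
theorem LieSubalgebra.isNilpotent_ad_of_killingPerp_le
    (hq : killingPerp q.toSubmodule ≤ q.toSubmodule) {x : q}
    (hx : _root_.IsNilpotent (ad ℂ q x)) : _root_.IsNilpotent (ad ℂ L (x : L)) := by
  obtain ⟨k, hk⟩ := hx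
  have h : ∀ j (y : q), (((ad ℂ q x) ^ j) y : L) = ((ad ℂ L (x : L)) ^ j) y := by
    intro j y
    induction j with
    | zero => rfl
    | succ j ih =>
      rw [pow_succ', pow_succ', Module.End.mul_apply, Module.End.mul_apply, ← ih]; rfl
  have h0 : ∀ y ∈ q, ((ad ℂ L (x : L)) ^ k) y = 0 := fun y hy => by
    rw [← h k ⟨y, hy⟩, hk]; rfl
  have hadj : ∀ j (y z : L), killingForm ℂ L (((ad ℂ L (x : L)) ^ j) y) z =
      (-1) ^ j * killingForm ℂ L y (((ad ℂ L (x : L)) ^ j) z) := by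
    intro j
    induction j with
    | zero => intro y z; simp
    | succ j ih =>
      intro y z
      rw [pow_succ', Module.End.mul_apply, ad_apply, killingForm_lie_left, ih, ← pow_succ',
        pow_succ (ad ℂ L (x : L)), Module.End.mul_apply, ad_apply]
      ring
  refine ⟨k + k, LinearMap.ext fun y => ?_⟩
  rw [pow_add, Module.End.mul_apply]
  -- By skewness the first k powers send L into q^⊥ ⊆ q, which the next k powers kill.
  refine h0 _ (hq (mem_killingPerp.2 fun z hz => ?_))
  rw [hadj, h0 z hz, map_zero, mul_zero]

/-- A nilpotent ideal of a subalgebra containing its orthogonal is orthogonal to the subalgebra. -/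
theorem LieIdeal.mem_killingPerp_of_isNilpotent
    (hq : killingPerp q.toSubmodule ≤ q.toSubmodule) (I : LieIdeal ℂ q) [LieRing.IsNilpotent I]
    {x : q} (hx : x ∈ I) : (x : L) ∈ killingPerp q.toSubmodule := by
  have hI : LieModule.IsNilpotent I L := (LieModule.isNilpotent_iff_forall (R := ℂ)).2 fun y =>
    LieSubalgebra.isNilpotent_ad_of_killingPerp_le hq (I.isNilpotent_ad_of_isNilpotent y.2)
  obtain ⟨k, hk⟩ := hI.nilpotent ℂ I L
  refine mem_killingPerp.2 fun y hy => ?_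
  -- The terms of `I.lcs L` are q-stable, and x ∈ I lowers them by one step; so `ad x * ad y` is
  -- nilpotent and has trace 0.
  have hmem : ∀ j (m : L), ((ad ℂ L (x : L) * ad ℂ L y) ^ j) m ∈ I.lcs L j := by
    intro j m
    induction j with
    | zero => exact LieSubmodule.mem_top _
    | succ j ih =>
      rw [pow_succ', Module.End.mul_apply, LieIdeal.lcs_succ]
      exact LieSubmodule.lie_mem_lie hx ((I.lcs L j).lie_mem (x := (⟨y, hy⟩ : q)) ih)
  refine (LinearMap.isNilpotent_trace_of_isNilpotent
    (f := ad ℂ L (x : L) * ad ℂ L y) ⟨k, LinearMap.ext fun m => ?_⟩).eq_zero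
  have := hmem k m
  rw [← LieSubmodule.mem_toSubmodule, LieIdeal.coe_lcs_eq, hk] at this
  exact this

theorem IsBorel.killingPerp_le_of_le (hb : IsBorel b) (hbq : b ≤ q) :
    killingPerp q.toSubmodule ≤ q.toSubmodule :=
  (killingPerp_anti hbq).trans (hb.killingPerp_le.trans hbq)

end Killing

variable {G L : Type*} [LieRing G] [LieAlgebra ℂ G] [FiniteDimensional ℂ G] [LieRing L]
  [LieAlgebra ℂ L] [FiniteDimensional ℂ L] [IsKilling ℂ L]
  {f : G →ₗ⁅ℂ⁆ L} [IsSolvable f.ker] {b q : LieSubalgebra ℂ G}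

/-- Modulo the radical, the nilradical of a parabolic subalgebra is its orthogonal. -/
theorem LieSubalgebra.map_nilradical (hf : Function.Surjective f) (hb : IsBorel b) (hbq : b ≤ q) :
    q.nilradical.map (f : G →ₗ[ℂ] L) = killingPerp (q.map f).toSubmodule := by
  have hb' := hb.map hf
  have hbq' : b.map f ≤ q.map f := by
    intro x hx
    obtain ⟨y, hy, rfl⟩ := (mem_map f b x).1 hx
    exact (mem_map f q _).2 ⟨y, hbq hy, rfl⟩
  have hperp := hb'.killingPerp_le_of_le hbq'
  let s : LieIdeal ℂ q :=
    { (killingPerp (q.map f).toSubmodule).comap ((f : G →ₗ[ℂ] L) ∘ₗ q.toSubmodule.subtype) with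
      lie_mem := fun {x y} hy => by
        change f ⁅(x : G), (y : G)⁆ ∈ killingPerp _
        rw [f.map_lie]
        exact lie_mem_killingPerp (fun v hv => (q.map f).lie_mem
          ((mem_map f q _).2 ⟨x, x.2, rfl⟩) hv) hy }
  have hs : ∀ {x : q}, x ∈ s ↔ f x ∈ killingPerp (q.map f).toSubmodule := Iff.rfl
  apply le_antisymm
  · rintro _ ⟨_, ⟨x, hx, rfl⟩, rfl⟩
    suffices lieNilradical q ≤ s from this hx
    refine sSup_le fun I hI x hx => hs.2 ?_
    have : LieRing.IsNilpotent I := hI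
    have hsurj := q.mapHom_surjective f
    let g : I →ₗ⁅ℂ⁆ I.map (q.mapHom f) :=
      { toFun := fun x => ⟨q.mapHom f x, LieIdeal.mem_map x.2⟩
        map_add' := fun x y => Subtype.ext (map_add (q.mapHom f) (x : q) y)
        map_smul' := fun c x => Subtype.ext (map_smul (q.mapHom f) c (x : q))
        map_lie' := fun {x y} => Subtype.ext ((q.mapHom f).map_lie (x : q) y) }
    have hg : Function.Surjective g := by
      rintro ⟨y, hy⟩
      obtain ⟨x, rfl⟩ := LieIdeal.mem_map_of_surjective hsurj hy
      exact ⟨x, rfl⟩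
    have : LieRing.IsNilpotent (I.map (q.mapHom f)) := hg.lieAlgebra_isNilpotent
    exact (I.map (q.mapHom f)).mem_killingPerp_of_isNilpotent hperp
      (LieIdeal.mem_map (f := q.mapHom f) hx)
  · have hbs := hb.isSolvable
    let g : s →ₗ⁅ℂ⁆ b :=
      { toFun := fun x => ⟨x.1.1, hb.mem_of_map_mem (f := f)
          (hb'.killingPerp_le (killingPerp_anti hbq' x.2))⟩
        map_add' := fun _ _ => rfl
        map_smul' := fun _ _ => rfl
        map_lie' := rfl }
    have hg : Function.Injective g := fun x y h =>
      Subtype.ext (Subtype.ext (congrArg (fun z : b => (z : G)) h))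
    have : IsSolvable s := hg.lieAlgebra_isSolvable
    -- The solvable ideal s need not be nilpotent, as it contains the kernel of f; but [q,s] is, and
    -- it suffices because weight vectors of nonzero weight are brackets with H.
    have hJ : LieRing.IsNilpotent (⁅(⊤ : LieIdeal ℂ q), s⁆ : LieIdeal ℂ q) := by
      refine (LieAlgebra.isNilpotent_iff_forall (R := ℂ)).2 fun x => ?_
      obtain ⟨k, hk⟩ := s.isNilpotent_toEnd_of_mem_top_lie q x.2
      refine ⟨k, LinearMap.ext fun y => Subtype.ext ?_⟩
      have h : ∀ j, (((ad ℂ _ x) ^ j) y : q) = ((toEnd ℂ q q (x : q)) ^ j) y := by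
        intro j
        induction j with
        | zero => rfl
        | succ j ih =>
          rw [pow_succ', pow_succ', Module.End.mul_apply, Module.End.mul_apply, ← ih]; rfl
      rw [h, hk]; rfl
    have hJn : ∀ x ∈ q, ∀ y ∈ q, f y ∈ killingPerp (q.map f).toSubmodule →
        ⁅x, y⁆ ∈ q.nilradical := fun x hx y hy hy' =>
      ⟨⁅(⟨x, hx⟩ : q), ⟨y, hy⟩⁆, (le_sSup hJ : _ ≤ lieNilradical q)
        (LieSubmodule.lie_mem_lie (LieSubmodule.mem_top _) (hs.2 hy')), rfl⟩
    obtain ⟨H, hH, hHb, -⟩ := hb'.exists_isCartanSubalgebra_le hb'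
    have hHq := hHb.trans hbq'
    intro v hv
    refine induction_of_cartan_stable (H := H) (V := killingPerp (q.map f).toSubmodule)
      (P := fun v => v ∈ q.nilradical.map (f : G →ₗ[ℂ] L))
      (fun h hh v hv => lie_mem_killingPerp (fun w hw => (q.map f).lie_mem (hHq hh) hw) hv)
      (Submodule.zero_mem _) (fun _ _ => Submodule.add_mem _) (fun α v hv hvα => ?_) hv
    by_cases hα : α = 0
    · subst hα
      rw [eq_zero_of_isNilpotent_ad_of_mem_isCartanSubalgebra ℂ L H
        (mem_cartan_of_mem_rootSpace_zero hvα)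
        (hb'.isNilpotent_ad (killingPerp_anti hbq' hv))]
      exact Submodule.zero_mem _
    · obtain ⟨h, hh⟩ := Function.ne_iff.1 hα
      have hhv : ⁅(h : L), v⁆ = α h • v := lie_eq_smul_of_mem_rootSpace hvα h
      have hv' : v = (α h)⁻¹ • ⁅(h : L), v⁆ := by rw [hhv, inv_smul_smul₀ hh]
      obtain ⟨x, hx, hxh⟩ := (mem_map f q _).1 (hHq h.2)
      obtain ⟨y, hy, hyv⟩ := (mem_map f q _).1 (hperp hv)
      rw [hv']
      refine Submodule.smul_mem _ _ ⟨⁅x, y⁆, hJn x hx y hy (hyv ▸ hv), ?_⟩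
      rw [LieHom.coe_toLinearMap, f.map_lie, hxh, hyv]

end Nilradical

/-! ### The semisimple quotient -/

section Radical

open LieAlgebra

variable (G : Type*) [LieRing G] [LieAlgebra ℂ G]

/-- The quotient map of a Lie algebra by its radical. -/
def LieAlgebra.toRadicalQuotient : G →ₗ⁅ℂ⁆ G ⧸ radical ℂ G :=
  { (LieSubmodule.Quotient.mk' (radical ℂ G) : G →ₗ[ℂ] G ⧸ radical ℂ G) with
    map_lie' := fun {x y} => LieSubmodule.Quotient.mk_bracket (I := radical ℂ G) x y }

theorem LieAlgebra.toRadicalQuotient_surjective : Function.Surjective (toRadicalQuotient G) :=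
  LieSubmodule.Quotient.surjective_mk' _

theorem LieAlgebra.ker_toRadicalQuotient : (toRadicalQuotient G).ker = radical ℂ G := by
  ext x
  rw [LieHom.mem_ker]
  exact LieSubmodule.Quotient.mk_eq_zero' (N := radical ℂ G)

variable [FiniteDimensional ℂ G]

instance LieAlgebra.isSolvable_ker_toRadicalQuotient : IsSolvable (toRadicalQuotient G).ker := by
  rw [ker_toRadicalQuotient]
  infer_instance

instance LieAlgebra.finiteDimensional_quotient_radical :
    FiniteDimensional ℂ (G ⧸ radical ℂ G) :=
  inferInstanceAs (FiniteDimensional ℂ (G ⧸ (radical ℂ G).toSubmodule))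

instance LieAlgebra.hasTrivialRadical_quotient_radical :
    HasTrivialRadical ℂ (G ⧸ radical ℂ G) := by
  rw [hasTrivialRadical_iff_no_solvable_ideals]
  intro I hI
  have h1 : IsSolvable (I.toLieSubalgebra.comap (toRadicalQuotient G)) :=
    have : IsSolvable I.toLieSubalgebra := hI
    LieSubalgebra.isSolvable_comap _ _
  have h2 : IsSolvable (I.comap (toRadicalQuotient G)) := h1
  have h3 := (LieIdeal.solvable_iff_le_radical ℂ G _).1 h2
  rw [eq_bot_iff]
  intro x hx
  obtain ⟨y, rfl⟩ := toRadicalQuotient_surjective G x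
  have hy : y ∈ radical ℂ G := h3 hx
  rw [← ker_toRadicalQuotient, LieHom.mem_ker] at hy
  rw [hy]
  exact LieSubmodule.zero_mem _

end Radical

/-! ### Transport of structure along the conjugation -/

namespace LieConjugation

open LieAlgebra

variable {G : Type*} [LieRing G] [LieAlgebra ℂ G] (σ : LieConjugation G) {p q : LieSubalgebra ℂ G}

theorem mem_image {V : Submodule ℂ G} {x : G} : x ∈ σ.image V ↔ σ.toMap x ∈ V := by
  constructor
  · rintro ⟨y, hy, rfl⟩
    rw [σ.involutive]
    exact hy
  · intro hx
    exact ⟨_, hx, σ.involutive x⟩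

theorem mem_imageLie {x : G} : x ∈ σ.imageLie q ↔ σ.toMap x ∈ q := σ.mem_image

theorem imageLie_imageLie (q : LieSubalgebra ℂ G) : σ.imageLie (σ.imageLie q) = q := by
  ext x
  rw [mem_imageLie, mem_imageLie, σ.involutive]

theorem imageLie_mono (h : p ≤ q) : σ.imageLie p ≤ σ.imageLie q := fun _ hx =>
  σ.mem_imageLie.2 (h (σ.mem_imageLie.1 hx))

theorem isSolvable_imageLie (q : LieSubalgebra ℂ G) [IsSolvable q] : IsSolvable (σ.imageLie q) := by
  -- σ is only conjugate-linear, so it is used as a morphism over ℤ; solvability does not depend on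
  -- the scalars.
  let g : σ.imageLie q →ₗ⁅ℤ⁆ q :=
    { toFun := fun x => ⟨σ.toMap x, σ.mem_imageLie.1 x.2⟩
      map_add' := fun x y => Subtype.ext (map_add σ.toMap (x : G) y)
      map_smul' := fun c x => Subtype.ext (map_zsmul σ.toMap c (x : G))
      map_lie' := fun {x y} => Subtype.ext (σ.map_lie (x : G) y) }
  have hg : Function.Injective g := fun x y h => Subtype.ext (by
    have := congrArg (fun z : q => σ.toMap z) h
    exact (σ.involutive x).symm.trans (this.trans (σ.involutive y)))
  exact hg.lieAlgebra_isSolvable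

theorem isBorel_imageLie {b : LieSubalgebra ℂ G} (hb : IsBorel b) : IsBorel (σ.imageLie b) := by
  have := hb.isSolvable
  refine ⟨σ.isSolvable_imageLie b, fun t ht hbt => ?_⟩
  have := ht
  have hle : b ≤ σ.imageLie t := by
    rw [← σ.imageLie_imageLie b]; exact σ.imageLie_mono hbt
  rw [← σ.imageLie_imageLie t]
  exact σ.imageLie_mono (hb.2 (σ.isSolvable_imageLie t) hle)

/-- The preimage of an ideal under a conjugation mapping a subalgebra to another one. -/
def comapIdeal (h : ∀ x ∈ p, σ.toMap x ∈ q) (J : LieIdeal ℂ q) : LieIdeal ℂ p where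
  carrier := {x | (⟨σ.toMap x, h x x.2⟩ : q) ∈ J}
  add_mem' := by
    intro x y hx hy
    have := J.add_mem hx hy
    simpa using this
  zero_mem' := by
    have heq : (⟨σ.toMap (0 : p), h _ p.zero_mem⟩ : q) = 0 := Subtype.ext (map_zero σ.toMap)
    rw [Set.mem_ofPred_eq, heq]
    exact J.zero_mem
  smul_mem' := by
    intro c x hx
    have := J.smul_mem (starRingEnd ℂ c) hx
    simpa using this
  lie_mem := by
    intro x y hy
    have := lie_mem_right ℂ q J ⟨σ.toMap x, h x x.2⟩ _ hy
    have heq : (⟨σ.toMap ⁅x, y⁆, h _ (p.lie_mem x.2 y.2)⟩ : q) =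
      ⁅(⟨σ.toMap x, h x x.2⟩ : q), ⟨σ.toMap y, h y y.2⟩⁆ := Subtype.ext (σ.map_lie _ _)
    change (⟨σ.toMap ⁅x, y⁆, h _ (p.lie_mem x.2 y.2)⟩ : q) ∈ J
    rw [heq]
    exact this

theorem mem_comapIdeal (h : ∀ x ∈ p, σ.toMap x ∈ q) (J : LieIdeal ℂ q) {x : p} :
    x ∈ σ.comapIdeal h J ↔ (⟨σ.toMap x, h x x.2⟩ : q) ∈ J := Iff.rfl

theorem isNilpotent_comapIdeal (h : ∀ x ∈ p, σ.toMap x ∈ q) (J : LieIdeal ℂ q)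
    [LieRing.IsNilpotent J] : LieRing.IsNilpotent (σ.comapIdeal h J) := by
  let g : σ.comapIdeal h J →ₗ⁅ℤ⁆ J :=
    { toFun := fun x => ⟨⟨σ.toMap x, h _ x.1.2⟩, (σ.mem_comapIdeal h J).1 x.2⟩
      map_add' := fun x y => Subtype.ext (Subtype.ext (map_add σ.toMap (x : G) y))
      map_smul' := fun c x => Subtype.ext (Subtype.ext (map_zsmul σ.toMap c (x : G)))
      map_lie' := fun {x y} => Subtype.ext (Subtype.ext (σ.map_lie (x : G) y)) }
  have hg : Function.Injective g := fun x y h => Subtype.ext (Subtype.ext (by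
    have := congrArg (fun z : J => σ.toMap z) h
    exact (σ.involutive x).symm.trans (this.trans (σ.involutive y))))
  exact hg.lieAlgebra_isNilpotent

theorem image_nilradical_le (q : LieSubalgebra ℂ G) :
    σ.image q.nilradical ≤ (σ.imageLie q).nilradical := by
  have h : ∀ x ∈ q, σ.toMap x ∈ σ.imageLie q := fun x hx => ⟨x, hx, rfl⟩
  have h' : ∀ x ∈ σ.imageLie q, σ.toMap x ∈ q := fun x hx => σ.mem_imageLie.1 hx
  rintro _ ⟨_, ⟨x, hx, rfl⟩, rfl⟩
  refine ⟨⟨σ.toMap x, h x x.2⟩, ?_, rfl⟩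
  refine (σ.mem_comapIdeal h (lieNilradical (σ.imageLie q))).1 (?_ : x ∈ _)
  revert x
  suffices lieNilradical q ≤ σ.comapIdeal h (lieNilradical (σ.imageLie q)) from fun x hx => this hx
  refine sSup_le fun I hI x hx => (σ.mem_comapIdeal h _).2 ?_
  have : LieRing.IsNilpotent I := hI
  have heq : (⟨σ.toMap (σ.toMap x), h' _ (h x x.2)⟩ : q) = x := Subtype.ext (σ.involutive x)
  have hx' : (⟨σ.toMap (σ.toMap x), h' _ (h x x.2)⟩ : q) ∈ I := by rw [heq]; exact hx
  exact (le_sSup (σ.isNilpotent_comapIdeal h' I) : _ ≤ lieNilradical _)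
    ((σ.mem_comapIdeal h' I (x := ⟨σ.toMap x, h x x.2⟩)).2 hx')

theorem nilradical_imageLie (q : LieSubalgebra ℂ G) :
    (σ.imageLie q).nilradical = σ.image q.nilradical := by
  refine le_antisymm ?_ (σ.image_nilradical_le q)
  intro x hx
  have := σ.image_nilradical_le (σ.imageLie q) (σ.mem_image.2 (by rwa [σ.involutive]) :
    σ.toMap x ∈ _)
  rw [imageLie_imageLie] at this
  exact σ.mem_image.2 this

end LieConjugation

/-! ### Weak integrability and the Levi-order -/

namespace CRAlgebra

open LieAlgebra LieSubalgebra

variable {G : Type*} [LieRing G] [LieAlgebra ℂ G] (A : CRAlgebra G)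

theorem polarization_contactSpace :
    A.polarization.contactSpace = A.q.toSubmodule ⊓ A.qConj.toSubmodule ⊔ A.q.nilradical ⊔
      A.σ.image A.q.nilradical := by
  have h : A.polarization.qConj.toSubmodule =
      A.q.toSubmodule ⊓ A.qConj.toSubmodule ⊔ A.σ.image A.q.nilradical := by
    change (A.q.toSubmodule ⊓ A.qConj.toSubmodule ⊔ A.q.nilradical).map A.σ.toMap = _
    rw [Submodule.map_sup]
    congr 1
    ext x
    change x ∈ A.σ.image (A.q.toSubmodule ⊓ A.qConj.toSubmodule) ↔ _
    rw [LieConjugation.mem_image, Submodule.mem_inf, Submodule.mem_inf, and_comm]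
    refine and_congr ?_ A.σ.mem_imageLie.symm
    change A.σ.toMap x ∈ A.σ.imageLie A.q ↔ _
    rw [LieConjugation.mem_imageLie, A.σ.involutive]
    rfl
  rw [contactSpace, h]
  change A.q.toSubmodule ⊓ A.qConj.toSubmodule ⊔ A.q.nilradical ⊔ _ = _
  rw [sup_sup_sup_comm, sup_idem, sup_assoc]

theorem isWeaklyIntegrable_iff : A.IsWeaklyIntegrable ↔ A.polarization.IsIntegrable := by
  rw [IsIntegrable, polarization_contactSpace, IsWeaklyIntegrable]

variable {A} [FiniteDimensional ℂ G]

/-- The radical lies in q and σ(q), so membership in q + σ(q) can be tested in the semisimple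
quotient, and the image of q ∩ σ(q) is the intersection of the images. -/
theorem lie_lie_lie_mem_contactSpace (hA : A.IsParabolic) (hW : A.IsWeaklyIntegrable) {Z : G}
    (h0 : Z ∈ A.contactSpace) (h1 : ∀ X ∈ A.q, ⁅Z, X⁆ ∈ A.contactSpace)
    (h2 : ∀ X ∈ A.q, ∀ Y ∈ A.q, ⁅⁅Z, X⁆, Y⁆ ∈ A.contactSpace) :
    ∀ X₁ ∈ A.q, ∀ X₂ ∈ A.q, ∀ X₃ ∈ A.q, ⁅⁅⁅Z, X₁⁆, X₂⁆, X₃⁆ ∈ A.contactSpace := by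
  obtain ⟨b, hb, hbq⟩ := hA
  have hb' : IsBorel (A.σ.imageLie b) := A.σ.isBorel_imageLie hb
  have hbq' : A.σ.imageLie b ≤ A.qConj := A.σ.imageLie_mono hbq
  set f := toRadicalQuotient G with hf
  have hsurj : Function.Surjective f := toRadicalQuotient_surjective G
  have hmono : ∀ {s t : LieSubalgebra ℂ G}, s ≤ t → s.map f ≤ t.map f := by
    intro s t hst x hx
    obtain ⟨y, hy, rfl⟩ := (mem_map f s x).1 hx
    exact (mem_map f t _).2 ⟨y, hst hy, rfl⟩
  have hn := (hb.map hsurj).killingPerp_le_of_le (hmono hbq)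
  have hn' := (hb'.map hsurj).killingPerp_le_of_le (hmono hbq')
  obtain ⟨H, hH, hHb, hHb'⟩ := (hb.map hsurj).exists_isCartanSubalgebra_le (hb'.map hsurj)
  have hker : ∀ x, f x = 0 → x ∈ A.qConj := fun x hx => hbq' (hb'.ker_le (f := f) hx)
  have hV : A.contactSpace.map (f : G →ₗ[ℂ] _) =
      (A.q.map f).toSubmodule ⊔ (A.qConj.map f).toSubmodule := Submodule.map_sup _ _ _
  have hmem : ∀ x, f x ∈ (A.q.map f).toSubmodule ⊔ (A.qConj.map f).toSubmodule ↔
      x ∈ A.contactSpace := by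
    intro x
    rw [← hV]
    refine ⟨?_, fun hx => ⟨x, hx, rfl⟩⟩
    rintro ⟨y, hy, hyx⟩
    have hyx' : f (x - y) = 0 := by
      rw [map_sub, sub_eq_zero]; exact hyx.symm
    rw [← add_sub_cancel y x]
    exact Submodule.add_mem _ hy (Submodule.mem_sup_right (hker _ hyx'))
  have hS : (A.q.toSubmodule ⊓ A.qConj.toSubmodule ⊔ A.q.nilradical ⊔
      A.σ.image A.q.nilradical).map (f : G →ₗ[ℂ] _) =
      (A.q.map f).toSubmodule ⊓ (A.qConj.map f).toSubmodule ⊔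
        killingPerp (A.q.map f).toSubmodule ⊔ killingPerp (A.qConj.map f).toSubmodule := by
    rw [Submodule.map_sup, Submodule.map_sup, ← A.σ.nilradical_imageLie, map_nilradical hsurj hb hbq]
    rw [show (A.σ.imageLie A.q).nilradical.map (f : G →ₗ[ℂ] _) =
      killingPerp (A.qConj.map f).toSubmodule from map_nilradical hsurj hb' hbq']
    congr 2
    refine le_antisymm (Submodule.map_inf_le _) ?_
    rintro _ ⟨⟨x, hx, rfl⟩, ⟨y, hy, hxy⟩⟩
    refine ⟨x, ⟨hx, ?_⟩, rfl⟩
    have hyx' : f (x - y) = 0 := by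
      rw [map_sub, sub_eq_zero]; exact hxy.symm
    rw [← add_sub_cancel y x]
    exact Submodule.add_mem _ hy (hker _ hyx')
  have hS' : IsLieSubalgebra ((A.q.map f).toSubmodule ⊓ (A.qConj.map f).toSubmodule ⊔
        killingPerp (A.q.map f).toSubmodule ⊔ killingPerp (A.qConj.map f).toSubmodule) := by
    rw [← hS]
    rintro _ ⟨x, hx, rfl⟩ _ ⟨y, hy, rfl⟩
    exact ⟨⁅x, y⁆, hW x hx y hy, f.map_lie x y⟩
  intro X₁ hX₁ X₂ hX₂ X₃ hX₃
  have hq : ∀ {x}, x ∈ A.q → f x ∈ A.q.map f := fun {x} hx => (mem_map f A.q _).2 ⟨x, hx, rfl⟩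
  rw [← hmem, f.map_lie, f.map_lie, f.map_lie]
  refine lie_lie_lie_mem_sup (hHb.trans (hmono hbq)) (hHb'.trans (hmono hbq')) hn hn' hS'
    ((hmem Z).2 h0) ?_ ?_ _ (hq hX₁) _ (hq hX₂) _ (hq hX₃)
  · rintro _ ⟨X, hX, rfl⟩
    have := (hmem _).2 (h1 X hX)
    rwa [f.map_lie] at this
  · rintro _ ⟨X, hX, rfl⟩ _ ⟨Y, hY, rfl⟩
    have := (hmem _).2 (h2 X hX Y hY)
    rwa [f.map_lie, f.map_lie] at this

/-- The case of length 3 says that [Z,X] satisfies the same three assumptions as Z, which drives an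
induction on the list. -/
theorem higherCommutator_mem_contactSpace (hA : A.IsParabolic) (hW : A.IsWeaklyIntegrable) {Z : G}
    (h0 : Z ∈ A.contactSpace) (h1 : ∀ X ∈ A.q, ⁅Z, X⁆ ∈ A.contactSpace)
    (h2 : ∀ X ∈ A.q, ∀ Y ∈ A.q, ⁅⁅Z, X⁆, Y⁆ ∈ A.contactSpace) (Zs : List G)
    (hZs : ∀ W ∈ Zs, W ∈ A.q) : higherCommutator Z Zs ∈ A.contactSpace := by
  induction Zs generalizing Z with
  | nil => exact h0
  | cons X Zs ih =>
    have hX := hZs X List.mem_cons_self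
    exact ih (h1 X hX) (h2 X hX) (lie_lie_lie_mem_contactSpace hA hW h0 h1 h2 X hX)
      fun W hW => hZs W (List.mem_cons_of_mem _ hW)

theorem elementLeviOrder_eq_top_or_le_two (hA : A.IsParabolic) (hW : A.IsWeaklyIntegrable) {Z : G}
    (hZ : Z ∈ A.contactSpace) : A.elementLeviOrder Z = ⊤ ∨ A.elementLeviOrder Z ≤ 2 := by
  rw [or_iff_not_imp_right, not_le]
  intro h
  have hlen : ∀ Zs : List G, (∀ W ∈ Zs, W ∈ A.q) → Zs.length ≤ 2 →
      higherCommutator Z Zs ∈ A.contactSpace := by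
    intro Zs hZs hlen
    by_contra hmem
    have h' : A.elementLeviOrder Z ≤ Zs.length := iInf₂_le Zs ⟨hZs, hmem⟩
    exact absurd (h.trans_le h') (not_lt.2 (by exact_mod_cast hlen))
  have h1 : ∀ X ∈ A.q, ⁅Z, X⁆ ∈ A.contactSpace := fun X hX => hlen [X] (by simpa) (by simp)
  have h2 : ∀ X ∈ A.q, ∀ Y ∈ A.q, ⁅⁅Z, X⁆, Y⁆ ∈ A.contactSpace := fun X hX Y hY =>
    hlen [X, Y] (by simp [hX, hY]) (by simp)
  rw [elementLeviOrder, iInf₂_eq_top]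
  exact fun Zs hZs => absurd (higherCommutator_mem_contactSpace hA hW hZ h1 h2 Zs hZs.1) hZs.2

theorem leviOrder_eq_top_or_le_two (hA : A.IsParabolic) (hW : A.IsWeaklyIntegrable) :
    A.leviOrder = ⊤ ∨ A.leviOrder ≤ 2 := by
  by_cases h : ∃ Z, (Z ∈ A.qConj ∧ Z ∉ A.q) ∧ A.elementLeviOrder Z = ⊤
  · obtain ⟨Z, hZ, hZ'⟩ := h
    exact Or.inl (top_le_iff.1 (hZ'.ge.trans (le_iSup₂ (f := fun Z _ => A.elementLeviOrder Z) Z hZ)))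
  · push Not at h
    refine Or.inr (iSup₂_le fun Z hZ => ?_)
    exact (elementLeviOrder_eq_top_or_le_two hA hW (Submodule.mem_sup_right hZ.1)).resolve_left
      (h Z hZ)

end CRAlgebra

theorem mainTheorem2 {𝔤 : Type*} [LieRing 𝔤] [LieAlgebra ℂ 𝔤] [FiniteDimensional ℂ 𝔤]
    (A : CRAlgebra 𝔤) (hA : A.IsParabolic) :
    (A.IsWeaklyIntegrable ↔ A.polarization.IsIntegrable) ∧
      (A.IsWeaklyIntegrable → A.leviOrder = ⊤ ∨ A.leviOrder ≤ 2) := by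
  exact ⟨A.isWeaklyIntegrable_iff, CRAlgebra.leviOrder_eq_top_or_le_two hA⟩
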